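/- Let $k$ be a field and let $\mathcal C$ be a symmetric rigid tensor category over $k$: a rigid, $k$-linear abelian symmetric monoidal category with $k$-bilinear tensor product, finite dimensional $\mathrm{Hom}$ spaces, all objects of finite length, and $\mathrm{End}(\mathbf 1)=k$. Let $c$ be its commutativity constraint. Let $m\ge 1$ be an integer with $\mathrm{char}(k)=0$ or $\mathrm{char}(k)>m$, let $\alpha$ be a partition of $m-1$, and let $\beta$ be a partition of $m$ whose Young diagram is obtained from that of $\alpha$ by adding one box. Let $p(\beta)$ and $q(\beta)$ be the numbers of rows and columns of $\beta$. Let $X\in\mathcal C$, with dimension $d=\dim X:=ev_X\circ c_{X,X^*}\circ coev_X\in \mathrm{End}(\mathbf 1)=k$. The group $S_m$ acts on $X^{\otimes m}$ through $c$, and $S_{m-1}$ is identified with the stabilizer of $1$ in $S_m$, acting on the last $m-1$ factors of $X\otimes X^{\otimes m-1}$. For a bijective numbering $T_\beta$ of the boxes of $\beta$ by $1,\dots,m$, let $c_\beta=\big(\sum_{\sigma}\sigma\big)\big(\sum_{\tau}\mathrm{sgn}(\tau)\tau\big)\in k[S_m]$ be its Young symmetrizer, where $\sigma$ (respectively $\tau$)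 runs over the permutations preserving the rows (respectively columns) of $T_\beta$, and let $\mathbb S_\beta X:=c_\beta(X^{\otimes m})$ be the image of $c_\beta$ on $X^{\otimes m}$. For a bijective numbering $T_\alpha$ of the boxes of $\alpha$ by $2,\dots,m$ define $c_\alpha\in k[S_{m-1}]\subseteq k[S_m]$ and $\mathbb S_\alpha X\subseteq X^{\otimes m-1}$ likewise, and write $\mathbb S_\alpha X^*$ for the dual $(\mathbb S_\alpha X)^*$. Let $$\theta_{\alpha,\beta}:X\xrightarrow{\ id_X\otimes coev_{\mathbb S_\alpha X}\ }X\otimes \mathbb S_\alpha X\otimes \mathbb S_\alpha X^*\xrightarrow{\ c_\beta\otimes id\ }\mathbb S_\beta X\otimes \mathbb S_\alpha X^* ,$$ where $c_\beta$ is applied to $X\otimes \mathbb S_\alpha X\subseteq X^{\otimes m}$. If $T_\beta$ extends $T_\alpha$ (so that the added box has number $1$), then $c_\beta c_\alpha\ne 0$ in $k[S_m]$. Moreover, for any choice of $T_\alpha$ and $T_\beta$ with $c_\beta c_\alpha\neq 0$ in $k[S_m]$: 1) If $d\ne 1-q(\beta),\dots,p(\beta)-1$ in $k$, then $\theta_{\alpha,\beta}$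 is a split injection. 2) Suppose $\beta$ is a hook, that is, $\beta$ does not contain the box in row $2$ and column $2$. If $d\ne 1-q(\beta),\dots,-1,1,\dots,p(\beta)-1$ in $k$, then $\theta_{\alpha,\beta}$ is a split injection. -/

import Mathlib

open CategoryTheory MonoidalCategory

namespace SchurFunctor

section TensorPower

universe v u
variable {C : Type u} [Category.{v} C] [MonoidalCategory C]

/-- The tensor power `X ⊗ (X ⊗ (⋯ ⊗ 𝟙))` with `n` factors. -/
@[reducible] def tensorPow (X : C) : ℕ → C
  | 0 => 𝟙_ C
  | n + 1 => X ⊗ tensorPow X n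

variable [SymmetricCategory C]

/-- The symmetry exchanging the first two factors of `X ⊗ (X ⊗ Z)`. -/
def swapFirst (X Z : C) : X ⊗ (X ⊗ Z) ⟶ X ⊗ (X ⊗ Z) :=
  (α_ X X Z).inv ≫ (β_ X X).hom ▷ Z ≫ (α_ X X Z).hom

/-- The symmetry that moves the first factor of `X ^ (n + 1)` to position `j`, past the `j` factors
at the positions `1, …, j`, and keeps the order of the others (for `j ≤ n`). -/
def moveFirst (X : C) : (n : ℕ) → ℕ → (tensorPow X (n + 1) ⟶ tensorPow X (n + 1))
  | _, 0 => 𝟙 _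
  | 0, _ + 1 => 𝟙 _
  | n + 1, j + 1 => swapFirst X (tensorPow X n) ≫ X ◁ moveFirst X n j

/-- The permutation of the remaining positions when position `0` is deleted from the source and
position `σ 0` from the target. -/
def permTail {n : ℕ} (σ : Equiv.Perm (Fin (n + 1))) : Equiv.Perm (Fin n) :=
  Equiv.removeNone ((finSuccEquiv' 0).symm.trans (σ.trans (finSuccEquiv' (σ 0))))

/-- The symmetry of `X ^ n` that moves the factor at position `i` to position `σ i`. -/
def permMap (X : C) : (n : ℕ) → Equiv.Perm (Fin n) → (tensorPow X n ⟶ tensorPow X n)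
  | 0, _ => 𝟙 _
  | n + 1, σ => X ◁ permMap X n (permTail σ) ≫ moveFirst X n (σ 0)

theorem permTail_spec {n : ℕ} (σ : Equiv.Perm (Fin (n + 1))) (i : Fin n) :
    (σ 0).succAbove (permTail σ i) = σ i.succ := by
  have h := Equiv.removeNone_some
    ((finSuccEquiv' 0).symm.trans (σ.trans (finSuccEquiv' (σ 0)))) (x := i) (by
      have hne : σ i.succ ≠ σ 0 := fun h => Fin.succ_ne_zero i (σ.injective h)
      obtain ⟨y, hy⟩ := Fin.exists_succAbove_eq hne
      exact ⟨y, by simp [← hy]⟩)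
  have h' : some (permTail σ i) = finSuccEquiv' (σ 0) (σ i.succ) := by
    simpa [permTail] using h
  exact (finSuccEquiv'_eq_some.1 h'.symm).symm

theorem permTail_unique {n : ℕ} {σ : Equiv.Perm (Fin (n + 1))} {τ : Equiv.Perm (Fin n)}
    (h : ∀ i, (σ 0).succAbove (τ i) = σ i.succ) : permTail σ = τ :=
  Equiv.ext fun i => Fin.succAbove_right_injective ((permTail_spec σ i).trans (h i).symm)

theorem swapFirst_swapFirst (X Z : C) : swapFirst X Z ≫ swapFirst X Z = 𝟙 _ := by
  simp [swapFirst, ← comp_whiskerRight_assoc]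

theorem swapFirst_naturality (X : C) {Z W : C} (f : Z ⟶ W) :
    swapFirst X Z ≫ X ◁ X ◁ f = X ◁ X ◁ f ≫ swapFirst X W := by
  simp only [swapFirst, Category.assoc, ← associator_naturality_right]
  rw [← whisker_exchange_assoc, ← associator_inv_naturality_right_assoc]

theorem swapFirst_braid (X Z : C) :
    swapFirst X (X ⊗ Z) ≫ X ◁ swapFirst X Z ≫ swapFirst X (X ⊗ Z) =
      X ◁ swapFirst X Z ≫ swapFirst X (X ⊗ Z) ≫ X ◁ swapFirst X Z := by
  have h := congrArg (fun f => X ◁ (α_ X X Z).inv ≫ (α_ X (X ⊗ X) Z).inv ≫ f ▷ Z ≫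
    (α_ X (X ⊗ X) Z).hom ≫ X ◁ (α_ X X Z).hom) (BraidedCategory.yang_baxter X X X)
  simp only [swapFirst]
  simp only [comp_whiskerRight, Category.assoc] at h
  refine Eq.trans ?_ (h.trans ?_)
  · monoidal
  · monoidal

theorem moveFirst_comm (X : C) : ∀ (n a b : ℕ), a ≤ b → b ≤ n →
    swapFirst X (tensorPow X n) ≫ X ◁ moveFirst X n a ≫ moveFirst X (n + 1) (b + 1) =
      X ◁ moveFirst X n b ≫ moveFirst X (n + 1) a
  | n, 0, b, _, _ => by
      simp only [moveFirst, MonoidalCategory.whiskerLeft_id, Category.id_comp, Category.comp_id]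
      rw [← Category.assoc, swapFirst_swapFirst, Category.id_comp]
  | 0, a + 1, b, h1, h2 => by omega
  | n + 1, a + 1, 0, h1, h2 => by omega
  | n + 1, a + 1, b + 1, h1, h2 => by
      have ih := moveFirst_comm X n a b (by omega) (by omega)
      have e1 : moveFirst X (n + 1) (a + 1) =
        swapFirst X (tensorPow X n) ≫ X ◁ moveFirst X n a := rfl
      have e2 (c : ℕ) : moveFirst X (n + 1 + 1) (c + 1) =
        swapFirst X (X ⊗ tensorPow X n) ≫ X ◁ moveFirst X (n + 1) c := rfl
      have e3 : moveFirst X (n + 1) (b + 1) =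
        swapFirst X (tensorPow X n) ≫ X ◁ moveFirst X n b := rfl
      have e4 : tensorPow X (n + 1) = X ⊗ tensorPow X n := rfl
      rw [e2 (b + 1), e2 a, e1]
      simp only [MonoidalCategory.whiskerLeft_comp, Category.assoc]
      change swapFirst X (X ⊗ tensorPow X n) ≫ _ = _
      have nat1 := swapFirst_naturality X (moveFirst X n a)
      have nat2 := swapFirst_naturality X (moveFirst X n b)
      have br := swapFirst_braid X (tensorPow X n)
      have ih' := congrArg (fun f => X ◁ f) ih
      simp only [MonoidalCategory.whiskerLeft_comp] at ih'
      rw [reassoc_of% (show X ◁ X ◁ moveFirst X n a ≫ swapFirst X (X ⊗ tensorPow X n) =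
        swapFirst X (X ⊗ tensorPow X n) ≫ X ◁ X ◁ moveFirst X n a from nat1.symm)]
      rw [reassoc_of% br, ih', e3]
      simp only [MonoidalCategory.whiskerLeft_comp, Category.assoc]
      rw [reassoc_of% (show X ◁ X ◁ moveFirst X n b ≫ swapFirst X (X ⊗ tensorPow X n) =
        swapFirst X (X ⊗ tensorPow X n) ≫ X ◁ X ◁ moveFirst X n b from nat2.symm)]

/-- The symmetry exchanging the factors of `X ^ (n + 1)` at positions `i` and `i + 1`. -/
def adjacentSwap (X : C) : (n : ℕ) → Fin n → (tensorPow X (n + 1) ⟶ tensorPow X (n + 1))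
  | n + 1, i => Fin.cases (swapFirst X (tensorPow X n)) (fun j => X ◁ adjacentSwap X n j) i

theorem permTail_one (n : ℕ) : permTail (1 : Equiv.Perm (Fin (n + 1))) = 1 :=
  permTail_unique fun i => by simp

theorem permMap_one (X : C) : ∀ n : ℕ, permMap X n 1 = 𝟙 _
  | 0 => rfl
  | n + 1 => by
      have h : moveFirst X n ((1 : Equiv.Perm (Fin (n + 1))) 0 : Fin (n + 1)) = 𝟙 _ := by
        cases n <;> simp [moveFirst]
      rw [permMap, permTail_one, permMap_one X n, h]
      simp [tensorPow]

theorem succAbove_exchange {n : ℕ} {a b : Fin (n + 2)} {a' b' : Fin (n + 1)}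
    (h : a.succAbove b' = b) (h' : b.succAbove a' = a) (x : Fin n) :
    a.succAbove (b'.succAbove x) = b.succAbove (a'.succAbove x) := by
  simp only [Fin.succAbove, Fin.ext_iff, Fin.lt_def, Fin.val_castSucc, apply_ite Fin.val,
    Fin.val_succ] at *
  split_ifs at * <;> omega

theorem succAbove_values {n : ℕ} {a b : Fin (n + 2)} {a' b' : Fin (n + 1)}
    (h : a.succAbove b' = b) (h' : b.succAbove a' = a) :
    ((a : ℕ) ≤ b' ∧ (a' : ℕ) = a ∧ (b : ℕ) = b' + 1) ∨
      ((b : ℕ) ≤ a' ∧ (a : ℕ) = a' + 1 ∧ (b' : ℕ) = b) := by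
  simp only [Fin.succAbove, Fin.ext_iff, Fin.lt_def, Fin.val_castSucc, apply_ite Fin.val,
    Fin.val_succ] at *
  split_ifs at * <;> omega

theorem permMap_mul_adjacent (X : C) : ∀ (n : ℕ) (i : Fin n) (σ : Equiv.Perm (Fin (n + 1))),
    permMap X (n + 1) (σ * Equiv.swap i.castSucc i.succ) =
      adjacentSwap X n i ≫ permMap X (n + 1) σ
  | n + 1, i, σ => by
      refine Fin.cases ?_ (fun j => ?_) i
      · set τ := σ * Equiv.swap (Fin.castSucc (0 : Fin (n + 1))) (Fin.succ 0) with hτ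
        have h0 : τ 0 = σ 1 := by simp [hτ]
        have h1 : τ 1 = σ 0 := by simp [hτ]
        have h2 : ∀ i : Fin n, τ i.succ.succ = σ i.succ.succ := fun i => by
          simp only [hτ, Equiv.Perm.mul_apply]
          rw [Equiv.swap_apply_of_ne_of_ne] <;> simp [Fin.ext_iff]
        have a0 := permTail_spec σ 0
        have b0 := permTail_spec τ 0
        change (σ 0).succAbove (permTail σ 0) = σ 1 at a0
        change (τ 0).succAbove (permTail τ 0) = τ 1 at b0
        rw [h0, h1] at b0
        have tt : permTail (permTail τ) = permTail (permTail σ) := by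
          refine permTail_unique fun i => ?_
          refine Fin.succAbove_right_injective (p := τ 0) ?_
          rw [permTail_spec τ, h2, ← permTail_spec σ, ← permTail_spec (permTail σ), h0]
          exact (succAbove_exchange a0 b0 _).symm
        have key : X ◁ moveFirst X n (permTail τ 0 : Fin (n + 1)) ≫
            moveFirst X (n + 1) (σ 1 : Fin (n + 1 + 1)) =
            swapFirst X (tensorPow X n) ≫ X ◁ moveFirst X n (permTail σ 0 : Fin (n + 1)) ≫
              moveFirst X (n + 1) (σ 0 : Fin (n + 1 + 1)) := by
          rcases succAbove_values a0 b0 with ⟨hle, e1, e2⟩ | ⟨hle, e1, e2⟩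
          · rw [e1, e2, ← moveFirst_comm X n _ _ hle (Nat.le_of_lt_succ (permTail σ 0).2),
              reassoc_of% (swapFirst_swapFirst X (tensorPow X n))]
          · rw [e1, e2, ← moveFirst_comm X n _ _ hle (Nat.le_of_lt_succ (permTail τ 0).2)]
        have nat := swapFirst_naturality X (permMap X n (permTail (permTail σ)))
        rw [permMap, permMap, tt, h0, permMap, permMap]
        simp only [MonoidalCategory.whiskerLeft_comp, Category.assoc]
        rw [key, reassoc_of% (show X ◁ X ◁ permMap X n (permTail (permTail σ)) ≫
          swapFirst X (tensorPow X n) = swapFirst X (tensorPow X n) ≫ _ from nat.symm)]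
        rfl
      · set τ := σ * Equiv.swap (Fin.castSucc j.succ) (Fin.succ j.succ) with hτ
        have h0 : τ 0 = σ 0 := by
          simp only [hτ, Equiv.Perm.mul_apply]
          rw [Equiv.swap_apply_of_ne_of_ne] <;> simp [Fin.ext_iff]
        have tt : permTail τ = permTail σ * Equiv.swap j.castSucc j.succ := by
          refine permTail_unique fun i => ?_
          rw [h0, Equiv.Perm.mul_apply, permTail_spec, hτ, Equiv.Perm.mul_apply,
            ← Fin.succ_castSucc, Equiv.swap_apply_def, Equiv.swap_apply_def]
          simp only [Fin.succ_inj]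
          split_ifs <;> rfl
        rw [permMap, tt, permMap_mul_adjacent X n j (permTail σ), h0]
        have e : adjacentSwap X (n + 1) j.succ = X ◁ adjacentSwap X n j := rfl
        rw [e, permMap.eq_2 X (n + 1) σ, MonoidalCategory.whiskerLeft_comp, Category.assoc]

theorem permMap_mul (X : C) : ∀ (n : ℕ) (σ τ : Equiv.Perm (Fin n)),
    permMap X n (σ * τ) = permMap X n τ ≫ permMap X n σ
  | 0, _, _ => (Category.id_comp _).symm
  | n + 1, σ, τ => by
      have h : τ ∈ Submonoid.closure
          (Set.range fun i : Fin n => Equiv.swap i.castSucc i.succ) := by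
        rw [Equiv.Perm.mclosure_swap_castSucc_succ]; trivial
      induction h using Submonoid.closure_induction generalizing σ with
      | mem x hx =>
        obtain ⟨i, rfl⟩ := hx
        have h1 := permMap_mul_adjacent X n i 1
        rw [one_mul, permMap_one, Category.comp_id] at h1
        rw [h1]
        exact permMap_mul_adjacent X n i σ
      | one => rw [mul_one, permMap_one, Category.id_comp]
      | mul x y _ _ hx hy => rw [← mul_assoc, hy, hx, hy x, Category.assoc]

/-- The action of the symmetric group on `X ^ n` through the symmetry of the category. -/
def permAction (X : C) (n : ℕ) : Equiv.Perm (Fin n) →* End (tensorPow X n) where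
  toFun := permMap X n
  map_one' := permMap_one X n
  map_mul' := permMap_mul X n

theorem permAction_adjacent (X : C) (n : ℕ) (i : Fin n) :
    permAction X (n + 1) (Equiv.swap i.castSucc i.succ) = adjacentSwap X n i := by
  have h := permMap_mul_adjacent X n i 1
  rwa [one_mul, permMap_one, Category.comp_id] at h

end TensorPower

section GroupAlgebra

universe w v u

/-- The action of the group algebra `k[S_n]` on `X ^ n`. -/
noncomputable def groupAlgebraAction (k : Type w) [Field k] {C : Type u} [Category.{v} C]
    [Preadditive C] [Linear k C] [MonoidalCategory C] [SymmetricCategory C] (X : C) (n : ℕ) :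
    MonoidAlgebra k (Equiv.Perm (Fin n)) →ₐ[k] End (tensorPow X n) :=
  MonoidAlgebra.lift k (End (tensorPow X n)) (Equiv.Perm (Fin n)) (permAction X n)

/-- The inclusion `k[S_n] → k[S_(n+1)]` identifying `S_n` with the stabilizer of the first
position. -/
noncomputable def groupAlgebraIncl (k : Type w) [Field k] (n : ℕ) :
    MonoidAlgebra k (Equiv.Perm (Fin n)) →ₐ[k] MonoidAlgebra k (Equiv.Perm (Fin (n + 1))) :=
  MonoidAlgebra.mapDomainAlgHom k k (Equiv.Perm.viaEmbeddingHom (Fin.succEmb n))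

/-- A tableau of shape `μ`: a bijective numbering of the boxes of `μ` by the `n` tensor positions.
The box in row `i` and column `j` is `(i, j)`, with `i` and `j` counted from `0`. -/
abbrev Tableau (μ : YoungDiagram) (n : ℕ) := Fin n ≃ μ.cells

/-- The sum of the permutations that preserve every row of `T`. -/
noncomputable def rowSymmetrizer (k : Type w) [Field k] {μ : YoungDiagram} {n : ℕ}
    (T : Tableau μ n) : MonoidAlgebra k (Equiv.Perm (Fin n)) :=
  ∑ σ : Equiv.Perm (Fin n) with ∀ i, (T (σ i)).1.1 = (T i).1.1, MonoidAlgebra.single σ 1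

/-- The signed sum of the permutations that preserve every column of `T`. -/
noncomputable def colAntisymmetrizer (k : Type w) [Field k] {μ : YoungDiagram} {n : ℕ}
    (T : Tableau μ n) : MonoidAlgebra k (Equiv.Perm (Fin n)) :=
  ∑ σ : Equiv.Perm (Fin n) with ∀ i, (T (σ i)).1.2 = (T i).1.2,
    MonoidAlgebra.single σ ((Equiv.Perm.sign σ : ℤ) : k)

/-- The Young symmetrizer `c_T = a_T b_T` of a tableau. -/
noncomputable def youngSymmetrizer (k : Type w) [Field k] {μ : YoungDiagram} {n : ℕ}
    (T : Tableau μ n) : MonoidAlgebra k (Equiv.Perm (Fin n)) :=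
  rowSymmetrizer k T * colAntisymmetrizer k T

/-- A Young diagram is a hook if it does not contain the box in the second row and second column. -/
def IsHook (μ : YoungDiagram) : Prop := (1, 1) ∉ μ

end GroupAlgebra

section TensorCategory

universe w v u

/-- The finiteness conditions on a (rigid, `k`-linear, abelian) tensor category: finite dimensional
`Hom` spaces, every object of finite length, and `End 𝟙 = k`. -/
class IsTensorCategory (k : Type w) [Field k] (C : Type u) [Category.{v} C] [Abelian C]
    [Linear k C] [MonoidalCategory C] : Prop where
  finite_hom : ∀ X Y : C, Module.Finite k (X ⟶ Y)
  noetherian : ∀ X : C, IsNoetherianObject X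
  artinian : ∀ X : C, IsArtinianObject X
  end_unit : Function.Bijective (algebraMap k (End (𝟙_ C)))

variable (k : Type w) [Field k] {C : Type u} [Category.{v} C] [Abelian C] [Linear k C]
  [MonoidalCategory C] [SymmetricCategory C] [RightRigidCategory C]

/-- The dimension of `X`: the element of `k = End 𝟙` given by `ev ∘ c ∘ coev`. -/
noncomputable def dim [IsTensorCategory k C] (X : C) : k :=
  (Equiv.ofBijective _ (IsTensorCategory.end_unit (k := k) (C := C))).symm
    (η_ X Xᘁ ≫ (β_ X Xᘁ).hom ≫ ε_ X Xᘁ : 𝟙_ C ⟶ 𝟙_ C)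

/-- The endomorphism of `X ^ n` given by the Young symmetrizer of `T`. -/
noncomputable def youngMap {μ : YoungDiagram} {n : ℕ} (T : Tableau μ n) (X : C) :
    tensorPow X n ⟶ tensorPow X n :=
  groupAlgebraAction k X n (youngSymmetrizer k T)

/-- The Schur functor on objects: the image of the Young symmetrizer on `X ^ n`. -/
noncomputable def schur {μ : YoungDiagram} {n : ℕ} (T : Tableau μ n) (X : C) : C :=
  Limits.image (youngMap k T X)

/-- The morphism `θ : X ⟶ S_β X ⊗ (S_α X)ᘁ`: first `id ⊗ coev` for `S_α X`, then the Young
symmetrizer of `β` on `X ⊗ S_α X ⊆ X ⊗ X ^ n = X ^ (n + 1)`. -/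
noncomputable def theta {α β : YoungDiagram} {n : ℕ} (S : Tableau α n) (T : Tableau β (n + 1))
    (X : C) : X ⟶ schur k T X ⊗ (schur k S X)ᘁ :=
  (ρ_ X).inv ≫ X ◁ η_ (schur k S X) (schur k S X)ᘁ ≫
    (α_ X (schur k S X) (schur k S X)ᘁ).inv ≫
      (X ◁ Limits.image.ι (youngMap k S X) ≫ Limits.factorThruImage (youngMap k T X)) ▷
        (schur k S X)ᘁ

end TensorCategory

end SchurFunctor

/-!
Turning the factor `S_α X` of the source around, `θ` becomes the restriction of `c_β` to
`X ⊗ S_α X`. Whether `θ` splits can then be tested on `X ⊗ X ^ n`, for the action of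
`x = c_β c_α`, and `x` may be replaced there by any `f * x` with `f ∈ k[S_(n+1)]`. Tracing out
one of the `n` factors that are turned around replaces an element of `k[S_(n+1)]` by its partial
trace in `k[S_n]`, so by induction it suffices that some multiple of `x` has nonzero iterated
partial traces. Reading off coefficients of `1`, the partial trace is adjoint to multiplication by
`d + J` with `J` a Jucys–Murphy element, which turns the condition into `(∏ᵢ (d + Jᵢ)) * x ≠ 0`.
The product `∏ᵢ (d + Jᵢ)` is central and multiplies `c_β` by the product of `d + j - i` over the
boxes `(i, j) ≠ (0, 0)` of `β`. For a hook, `(0, 0)` is the only box with `i = j`, which is why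
`d = 0` is allowed there.
-/

namespace SchurFunctor

section CharacterSum

variable {R : Type*} [CommRing R] {G : Type*} [Group G]

/-- The sum of the elements of a finite subgroup `H`, weighted by the character `χ`. The row
symmetrizer and the column antisymmetrizer of a tableau are of this form. -/
noncomputable def characterSum (χ : G →* R) (H : Subgroup G) [Fintype H] : MonoidAlgebra R G :=
  ∑ h : H, MonoidAlgebra.single (h : G) (χ h)

variable (χ : G →* R) (H : Subgroup G) [Fintype H]

theorem single_mul_characterSum {g : G} (hg : g ∈ H) :
    MonoidAlgebra.single g (χ g) * characterSum χ H = characterSum χ H := by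
  rw [characterSum, Finset.mul_sum]
  exact Fintype.sum_equiv (Equiv.mulLeft (⟨g, hg⟩ : H)) _ _ fun x => by
    simp [MonoidAlgebra.single_mul_single]

theorem characterSum_mul_single {g : G} (hg : g ∈ H) :
    characterSum χ H * MonoidAlgebra.single g (χ g) = characterSum χ H := by
  rw [characterSum, Finset.sum_mul]
  exact Fintype.sum_equiv (Equiv.mulRight (⟨g, hg⟩ : H)) _ _ fun x => by
    simp [MonoidAlgebra.single_mul_single]

section Map

variable {G' : Type*} [Group G'] (φ : G' →* G) {χ' : G' →* R} {H' : Subgroup G'} [Fintype H']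
  {χ : G →* R} {H : Subgroup G} [Fintype H]

theorem mapDomain_characterSum_mul_characterSum (hφ : ∀ x ∈ H', φ x ∈ H)
    (hχ : ∀ x ∈ H', χ (φ x) = χ' x) :
    MonoidAlgebra.mapDomainAlgHom R R φ (characterSum χ' H') * characterSum χ H =
      Fintype.card H' • characterSum χ H := by
  rw [characterSum, map_sum, Finset.sum_mul, Fintype.card,
    Finset.sum_eq_card_nsmul fun x _ => ?_]
  simpa [hχ x x.2] using single_mul_characterSum χ H (hφ x x.2)

theorem characterSum_mul_mapDomain_characterSum (hφ : ∀ x ∈ H', φ x ∈ H)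
    (hχ : ∀ x ∈ H', χ (φ x) = χ' x) :
    characterSum χ H * MonoidAlgebra.mapDomainAlgHom R R φ (characterSum χ' H') =
      Fintype.card H' • characterSum χ H := by
  rw [characterSum.eq_1 χ', map_sum, Finset.mul_sum, Fintype.card,
    Finset.sum_eq_card_nsmul fun x _ => ?_]
  simpa [hχ x x.2] using characterSum_mul_single χ H (hφ x x.2)

end Map

section TwoSubgroups

variable {χ χ' : G →* R} {H K : Subgroup G} [Fintype H] [Fintype K]

theorem characterSum_mul_of_mul_characterSum_eq_zero {g s : G} (hH : g * s * g⁻¹ ∈ H) (hK : s ∈ K)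
    (hs : s * s = 1) (hs1 : s ≠ 1) (hχ : χ' s = -χ s) :
    characterSum χ H * MonoidAlgebra.of R G g * characterSum χ' K = 0 := by
  rw [characterSum.eq_1 χ', Finset.mul_sum]
  refine Finset.sum_involution (fun x _ => ⟨s, hK⟩ * x) (fun x _ => ?_)
    (fun x _ _ => by simpa using hs1) (fun _ _ => Finset.mem_univ _)
    (fun x _ => Subtype.ext <| by simp [← mul_assoc, hs])
  have hconj : MonoidAlgebra.of R G g * MonoidAlgebra.single (s * x) (χ' (s * x)) =
      -(MonoidAlgebra.single (g * s * g⁻¹) (χ (g * s * g⁻¹)) *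
        (MonoidAlgebra.of R G g * MonoidAlgebra.single (x : G) (χ' x))) := by
    have hχs : χ (g * s * g⁻¹) = χ s := by rw [map_mul, mul_comm, ← map_mul]; simp
    rw [hχs]
    simp [MonoidAlgebra.single_mul_single, mul_assoc, hχ, MonoidAlgebra.single_neg]
  rw [Subgroup.coe_mul, mul_assoc _ _ (MonoidAlgebra.single (s * x.1) _), hconj, mul_neg,
    ← mul_assoc, characterSum_mul_single χ H hH, mul_assoc, add_neg_cancel]

theorem coeff_one_characterSum_mul_characterSum (h : Disjoint H K) :
    (characterSum χ H * characterSum χ' K).coeff 1 = 1 := by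
  classical
  rw [characterSum, characterSum, Fintype.sum_mul_sum, ← Fintype.sum_prod_type',
    MonoidAlgebra.coeff_sum, Finset.sum_apply', Fintype.sum_eq_single 1 fun x hx => ?_]
  · simp
  · have hne : (x.1 : G) * x.2 ≠ 1 := fun he =>
      hx (Subgroup.mul_injective_of_disjoint h (by simpa using he))
    simp [MonoidAlgebra.single_mul_single, hne]

theorem of_mul_characterSum {g : G} (hg : ∀ x, x ∈ K ↔ g * x * g⁻¹ ∈ H) :
    MonoidAlgebra.of R G g * characterSum χ K = characterSum χ H * MonoidAlgebra.of R G g := by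
  rw [characterSum, characterSum, Finset.mul_sum, Finset.sum_mul]
  refine Fintype.sum_equiv ((MulAut.conj g).toEquiv.subtypeEquiv hg) _ _ fun x => ?_
  have hχ : χ (g * x * g⁻¹) = χ x := by rw [map_mul, mul_comm, ← map_mul]; simp
  simp [MonoidAlgebra.single_mul_single, hχ]

end TwoSubgroups

end CharacterSum

section CoeffOne

variable {R : Type*} [CommRing R] {G : Type*} [Group G]

theorem coeff_one_mul_comm (x y : MonoidAlgebra R G) : (x * y).coeff 1 = (y * x).coeff 1 := by
  classical
  induction x using MonoidAlgebra.induction_linear with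
  | zero => simp
  | add f g hf hg => simp [add_mul, mul_add, hf, hg]
  | single a r =>
    induction y using MonoidAlgebra.induction_linear with
    | zero => simp
    | add f g hf hg => simp [add_mul, mul_add, hf, hg]
    | single b s =>
      simp only [MonoidAlgebra.single_mul_single, MonoidAlgebra.coeff_single,
        Finsupp.single_apply, mul_comm r s, mul_eq_one_comm (a := a)]

theorem exists_coeff_one_of_mul_ne_zero {x : MonoidAlgebra R G} (hx : x ≠ 0) :
    ∃ g : G, (MonoidAlgebra.of R G g * x).coeff 1 ≠ 0 := by
  contrapose! hx
  ext g
  simpa using hx g⁻¹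

variable [Fintype G]

theorem trace_mulLeft (x : MonoidAlgebra R G) :
    LinearMap.trace R _ (LinearMap.mulLeft R x) = Fintype.card G * x.coeff 1 := by
  classical
  have hdiag (g : G) : Algebra.leftMulMatrix (MonoidAlgebra.basis G R) x g g = x.coeff 1 := by
    rw [Algebra.leftMulMatrix_eq_repr_mul, ← mul_one (x.coeff 1),
      ← MonoidAlgebra.coeff_mul_single_eq_coeff_mul (m := g) (m₁ := g) 1 (by simp)]
    rfl
  simp [LinearMap.trace_eq_matrix_trace R (MonoidAlgebra.basis G R), Matrix.trace, hdiag]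

theorem mul_self_ne_zero_of_coeff_one_ne_zero [IsDomain R] (hG : (Fintype.card G : R) ≠ 0)
    {x : MonoidAlgebra R G} (hx : x.coeff 1 ≠ 0) : x * x ≠ 0 := fun h => by
  have hnil : IsNilpotent (LinearMap.mulLeft R x) :=
    ⟨2, by rw [LinearMap.pow_mulLeft, pow_two, h, LinearMap.mulLeft_zero_eq_zero]⟩
  have htrace := (LinearMap.isNilpotent_trace_of_isNilpotent hnil).eq_zero
  rw [trace_mulLeft] at htrace
  exact mul_ne_zero hG hx htrace

end CoeffOne

section YoungSubgroup

variable {ι κ : Type*}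

/-- The Young subgroup of the partition of `ι` into the fibres of `f`: the permutations that
preserve every fibre. -/
def youngSubgroup (f : ι → κ) : Subgroup (Equiv.Perm ι) where
  carrier := {σ | ∀ i, f (σ i) = f i}
  mul_mem' {σ τ} hσ hτ i := (hσ (τ i)).trans (hτ i)
  one_mem' _ := rfl
  inv_mem' {σ} hσ i := by simpa using (hσ (σ⁻¹ i)).symm

instance [Fintype ι] [DecidableEq κ] (f : ι → κ) : DecidablePred (· ∈ youngSubgroup f) :=
  fun σ => inferInstanceAs (Decidable (∀ i, f (σ i) = f i))

theorem swap_mem_youngSubgroup [DecidableEq ι] {f : ι → κ} {i j : ι} (h : f i = f j) :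
    Equiv.swap i j ∈ youngSubgroup f := fun x => by
  rw [Equiv.swap_apply_def]
  split_ifs with hi hj
  · rw [hi, h]
  · rw [hj, h]
  · rfl

theorem disjoint_youngSubgroup {κ' : Type*} {f : ι → κ} {g : ι → κ'}
    (h : Function.Injective fun i => (f i, g i)) :
    Disjoint (youngSubgroup f) (youngSubgroup g) :=
  Subgroup.disjoint_def.2 fun hf hg => Equiv.ext fun i => h (Prod.ext (hf i) (hg i))

theorem mem_youngSubgroup_comp_iff {f : ι → κ} {g σ : Equiv.Perm ι} :
    σ ∈ youngSubgroup (f ∘ g) ↔ g * σ * g⁻¹ ∈ youngSubgroup f :=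
  ⟨fun h i => by simpa using h (g⁻¹ i), fun h i => by simpa using h (g i)⟩

variable [Fintype ι] {R : Type*} [CommSemiring R]

theorem cast_card_subgroup_ne_zero (h : ((Fintype.card ι).factorial : R) ≠ 0)
    (H : Subgroup (Equiv.Perm ι)) [Fintype H] : (Fintype.card H : R) ≠ 0 := by
  classical
  rw [← Fintype.card_perm] at h
  exact ne_zero_of_dvd_ne_zero h (Nat.cast_dvd_cast (by
    simpa [Nat.card_eq_fintype_card] using H.card_subgroup_dvd_card))

end YoungSubgroup

section Symmetrizers

variable {n : ℕ} {μ : YoungDiagram}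

/-- The row of `T` that contains a given number. -/
def rowOf (T : Tableau μ n) (i : Fin n) : ℕ := (T i).1.1

/-- The column of `T` that contains a given number. -/
def colOf (T : Tableau μ n) (i : Fin n) : ℕ := (T i).1.2

theorem injective_rowOf_colOf (T : Tableau μ n) :
    Function.Injective fun i => (rowOf T i, colOf T i) := fun _ _ h =>
  T.injective (Subtype.ext h)

theorem exists_rowOf_eq_colOf_eq (T : Tableau μ n) {i j : ℕ} (h : (i, j) ∈ μ) :
    ∃ u, rowOf T u = i ∧ colOf T u = j :=
  ⟨T.symm ⟨(i, j), h⟩, by simp [rowOf], by simp [colOf]⟩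

/-- The sign character with values in a commutative ring `R`. -/
def signChar (R : Type*) [CommRing R] (n : ℕ) : Equiv.Perm (Fin n) →* R :=
  (Int.castRingHom R : ℤ →* R).comp ((Units.coeHom ℤ).comp Equiv.Perm.sign)

theorem signChar_apply (R : Type*) [CommRing R] (σ : Equiv.Perm (Fin n)) :
    signChar R n σ = ((Equiv.Perm.sign σ : ℤ) : R) := rfl

variable {k : Type*} [Field k] (T : Tableau μ n)

theorem rowSymmetrizer_eq_characterSum :
    rowSymmetrizer k T = characterSum 1 (youngSubgroup (rowOf T)) :=
  Finset.sum_subtype _ (fun σ => by simp [youngSubgroup, rowOf]) _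

theorem colAntisymmetrizer_eq_characterSum :
    colAntisymmetrizer k T = characterSum (signChar k n) (youngSubgroup (colOf T)) :=
  Finset.sum_subtype _ (fun σ => by simp [youngSubgroup, colOf]) _

variable {T} {σ : Equiv.Perm (Fin n)}

theorem of_mul_rowSymmetrizer (h : σ ∈ youngSubgroup (rowOf T)) :
    MonoidAlgebra.of k _ σ * rowSymmetrizer k T = rowSymmetrizer k T := by
  rw [rowSymmetrizer_eq_characterSum]
  exact single_mul_characterSum 1 _ h

theorem rowSymmetrizer_mul_of (h : σ ∈ youngSubgroup (rowOf T)) :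
    rowSymmetrizer k T * MonoidAlgebra.of k _ σ = rowSymmetrizer k T := by
  rw [rowSymmetrizer_eq_characterSum]
  exact characterSum_mul_single 1 _ h

variable (k σ) in
theorem of_eq_sign_smul_single : MonoidAlgebra.of k _ σ =
    signChar k n σ • MonoidAlgebra.single σ (signChar k n σ) := by
  rw [MonoidAlgebra.smul_single, signChar_apply, smul_eq_mul, ← Int.cast_mul]
  simp

theorem of_mul_colAntisymmetrizer (h : σ ∈ youngSubgroup (colOf T)) :
    MonoidAlgebra.of k _ σ * colAntisymmetrizer k T =
      signChar k n σ • colAntisymmetrizer k T := by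
  rw [colAntisymmetrizer_eq_characterSum, of_eq_sign_smul_single, smul_mul_assoc,
    single_mul_characterSum _ _ h]

theorem colAntisymmetrizer_mul_of (h : σ ∈ youngSubgroup (colOf T)) :
    colAntisymmetrizer k T * MonoidAlgebra.of k _ σ =
      signChar k n σ • colAntisymmetrizer k T := by
  rw [colAntisymmetrizer_eq_characterSum, of_eq_sign_smul_single, mul_smul_comm,
    characterSum_mul_single _ _ h]

theorem rowSymmetrizer_mul_of_mul_colAntisymmetrizer_eq_zero {u v : Fin n} (huv : u ≠ v)
    (hcol : colOf T u = colOf T v) (hrow : rowOf T (σ u) = rowOf T (σ v)) :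
    rowSymmetrizer k T * MonoidAlgebra.of k _ σ * colAntisymmetrizer k T = 0 := by
  rw [rowSymmetrizer_eq_characterSum, colAntisymmetrizer_eq_characterSum]
  refine characterSum_mul_of_mul_characterSum_eq_zero (s := Equiv.swap u v) ?_
    (swap_mem_youngSubgroup hcol) (Equiv.swap_mul_self u v) (by simpa using huv)
    (by simp [signChar_apply, Equiv.Perm.sign_swap huv])
  rw [Equiv.mul_swap_eq_swap_mul, mul_inv_cancel_right]
  exact swap_mem_youngSubgroup hrow

theorem colAntisymmetrizer_mul_of_mul_rowSymmetrizer_eq_zero {u v : Fin n} (huv : u ≠ v)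
    (hrow : rowOf T u = rowOf T v) (hcol : colOf T (σ u) = colOf T (σ v)) :
    colAntisymmetrizer k T * MonoidAlgebra.of k _ σ * rowSymmetrizer k T = 0 := by
  rw [rowSymmetrizer_eq_characterSum, colAntisymmetrizer_eq_characterSum]
  refine characterSum_mul_of_mul_characterSum_eq_zero (s := Equiv.swap u v) ?_
    (swap_mem_youngSubgroup hrow) (Equiv.swap_mul_self u v) (by simpa using huv)
    (by simp [signChar_apply, Equiv.Perm.sign_swap huv])
  rw [Equiv.mul_swap_eq_swap_mul, mul_inv_cancel_right]
  exact swap_mem_youngSubgroup hcol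

variable (k T)

theorem coeff_one_youngSymmetrizer : (youngSymmetrizer k T).coeff 1 = 1 := by
  rw [youngSymmetrizer, rowSymmetrizer_eq_characterSum, colAntisymmetrizer_eq_characterSum]
  exact coeff_one_characterSum_mul_characterSum (disjoint_youngSubgroup (injective_rowOf_colOf T))

theorem of_mul_youngSymmetrizer_trans (g : Equiv.Perm (Fin n)) :
    MonoidAlgebra.of k _ g * youngSymmetrizer k (g.trans T) =
      youngSymmetrizer k T * MonoidAlgebra.of k _ g := by
  have hrow (σ : Equiv.Perm (Fin n)) : σ ∈ youngSubgroup (rowOf (g.trans T)) ↔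
      g * σ * g⁻¹ ∈ youngSubgroup (rowOf T) := mem_youngSubgroup_comp_iff (f := rowOf T)
  have hcol (σ : Equiv.Perm (Fin n)) : σ ∈ youngSubgroup (colOf (g.trans T)) ↔
      g * σ * g⁻¹ ∈ youngSubgroup (colOf T) := mem_youngSubgroup_comp_iff (f := colOf T)
  simp only [youngSymmetrizer, rowSymmetrizer_eq_characterSum, colAntisymmetrizer_eq_characterSum]
  rw [← mul_assoc, of_mul_characterSum hrow, mul_assoc, of_mul_characterSum hcol, mul_assoc]

end Symmetrizers

section VonNeumann

open Finset

theorem sum_range_lt_sum {s : Finset ℕ} {n : ℕ} (hs : #s = n) (h : s ≠ range n) :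
    ∑ i ∈ range n, i < ∑ i ∈ s, i := by
  subst hs
  have hcard : #(range #s \ s) = #(s \ range #s) := card_sdiff_comm (card_range _)
  have hne : (range #s \ s).Nonempty := sdiff_nonempty.2 fun hsub =>
    h (eq_of_subset_of_card_le hsub (card_range _).ge).symm
  rw [← sum_sdiff_lt_sum_sdiff]
  calc ∑ i ∈ range #s \ s, i < ∑ _i ∈ range #s \ s, #s :=
        sum_lt_sum_of_nonempty hne fun i hi => mem_range.1 (mem_sdiff.1 hi).1
    _ = #(s \ range #s) • #s := by rw [sum_const, hcard]
    _ ≤ ∑ i ∈ s \ range #s, i := card_nsmul_le_sum _ _ _ fun i hi =>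
        not_lt.1 fun hlt => (mem_sdiff.1 hi).2 (mem_range.2 hlt)

variable {n : ℕ} {μ : YoungDiagram} (T : Tableau μ n)

/-- The numbers in a given column of `T`. -/
def column (j : ℕ) : Finset (Fin n) := {u | colOf T u = j}

variable {T}

theorem mem_column {u : Fin n} {j : ℕ} : u ∈ column T j ↔ colOf T u = j := by simp [column]

theorem injOn_rowOf_column (j : ℕ) : Set.InjOn (rowOf T) (column T j) := fun _ hu _ hv h =>
  injective_rowOf_colOf T (Prod.ext h ((mem_column.1 hu).trans (mem_column.1 hv).symm))

theorem image_rowOf_column (j : ℕ) : (column T j).image (rowOf T) = range (μ.colLen j) := by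
  ext i
  simp only [mem_image, mem_column, mem_range, ← YoungDiagram.mem_iff_lt_colLen]
  constructor
  · rintro ⟨u, rfl, rfl⟩
    exact (T u).2
  · intro h
    obtain ⟨u, hu⟩ := exists_rowOf_eq_colOf_eq T h
    exact ⟨u, hu.2, hu.1⟩

/-- Summed over all columns, both families of sets `h '' column` and `row '' column` have the
same total, while the latter are initial segments, so that columnwise they have the smaller sum. -/
theorem mk_rowOf_colOf_mem {σ : Equiv.Perm (Fin n)}
    (h : ∀ j, Set.InjOn (fun u => rowOf T (σ u)) (column T j)) (u : Fin n) :
    (rowOf T (σ u), colOf T u) ∈ μ := by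
  have hsum {f : Fin n → ℕ} (hf : ∀ j, Set.InjOn f (column T j)) :
      ∑ j ∈ univ.image (colOf T), ∑ x ∈ (column T j).image f, x = ∑ u, f u := by
    rw [← sum_fiberwise_of_maps_to (fun u _ => mem_image_of_mem (colOf T) (mem_univ u))]
    exact sum_congr rfl fun j _ => sum_image (hf j)
  have hcard (j) : #((column T j).image fun u => rowOf T (σ u)) = μ.colLen j := by
    rw [card_image_of_injOn (h j), ← card_image_of_injOn (injOn_rowOf_column j),
      image_rowOf_column, card_range]
  have hle (j) : ∑ x ∈ range (μ.colLen j), x ≤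
      ∑ x ∈ (column T j).image fun u => rowOf T (σ u), x := by
    rcases eq_or_ne ((column T j).image fun u => rowOf T (σ u)) (range (μ.colLen j)) with hj | hj
    · rw [hj]
    · exact (sum_range_lt_sum (hcard j) hj).le
  have htotal := (hsum injOn_rowOf_column).trans
    ((Equiv.sum_comp σ (rowOf T)).symm.trans (hsum h).symm)
  simp only [image_rowOf_column] at htotal
  have heq := (sum_eq_sum_iff_of_le fun j _ => hle j).1 htotal (colOf T u)
    (mem_image_of_mem _ (mem_univ u))
  have himage : ((column T (colOf T u)).image fun u => rowOf T (σ u)) =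
      range (μ.colLen (colOf T u)) := by
    by_contra hne
    exact (sum_range_lt_sum (hcard _) hne).ne heq
  rw [YoungDiagram.mem_iff_lt_colLen, ← mem_range, ← himage]
  exact mem_image_of_mem (fun u => rowOf T (σ u)) (mem_column.2 rfl)

theorem exists_eq_mul_of_injOn_column {σ : Equiv.Perm (Fin n)}
    (h : ∀ j, Set.InjOn (fun u => rowOf T (σ u)) (column T j)) :
    ∃ r ∈ youngSubgroup (rowOf T), ∃ c ∈ youngSubgroup (colOf T), σ = r * c := by
  let f (u : Fin n) : Fin n := T.symm ⟨_, mk_rowOf_colOf_mem h u⟩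
  have hrow (u) : rowOf T (f u) = rowOf T (σ u) := by simp [f, rowOf]
  have hcol (u) : colOf T (f u) = colOf T u := by simp [f, colOf]
  have hf : Function.Injective f := fun u v huv =>
    h (colOf T v) (mem_column.2 (by rw [← hcol u, huv, hcol])) (mem_column.2 rfl)
      (by simpa only [hrow] using congrArg (rowOf T) huv)
  let c : Equiv.Perm (Fin n) := Equiv.ofBijective f (Finite.injective_iff_bijective.1 hf)
  refine ⟨σ * c⁻¹, fun u => ?_, c, hcol, (inv_mul_cancel_right σ c).symm⟩
  rw [Equiv.Perm.mul_apply, ← hrow]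
  exact congrArg (rowOf T) (c.apply_symm_apply u)

variable {k : Type*} [Field k]

theorem exists_colAntisymmetrizer_mul_mul_rowSymmetrizer (T : Tableau μ n)
    (x : MonoidAlgebra k (Equiv.Perm (Fin n))) :
    ∃ r : k, colAntisymmetrizer k T * x * rowSymmetrizer k T =
      r • (colAntisymmetrizer k T * rowSymmetrizer k T) := by
  induction x using MonoidAlgebra.induction_on with
  | of σ =>
    by_cases h : ∀ j, Set.InjOn (fun u => rowOf T (σ⁻¹ u)) (column T j)
    · obtain ⟨r, hr, c, hc, hσ⟩ := exists_eq_mul_of_injOn_column h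
      refine ⟨signChar k n c⁻¹, ?_⟩
      rw [inv_eq_iff_eq_inv.1 hσ, mul_inv_rev, map_mul, ← mul_assoc,
        colAntisymmetrizer_mul_of (inv_mem hc), mul_assoc, of_mul_rowSymmetrizer (inv_mem hr),
        smul_mul_assoc]
    · simp only [Set.InjOn, not_forall, Finset.mem_coe, mem_column] at h
      obtain ⟨j, u, hu, v, hv, hrow, huv⟩ := h
      refine ⟨0, ?_⟩
      rw [zero_smul, colAntisymmetrizer_mul_of_mul_rowSymmetrizer_eq_zero (σ⁻¹.injective.ne huv)
        hrow (by simp [hu, hv])]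
  | add x y hx hy =>
    obtain ⟨r, hr⟩ := hx
    obtain ⟨s, hs⟩ := hy
    exact ⟨r + s, by rw [mul_add, add_mul, hr, hs, add_smul]⟩
  | smul t x hx =>
    obtain ⟨r, hr⟩ := hx
    exact ⟨t * r, by rw [mul_smul_comm, smul_mul_assoc, hr, smul_smul]⟩

theorem exists_colAntisymmetrizer_mul_rowSymmetrizer_mul_self (h : (n.factorial : k) ≠ 0)
    (T : Tableau μ n) :
    ∃ r ≠ (0 : k), colAntisymmetrizer k T * rowSymmetrizer k T *
        (colAntisymmetrizer k T * rowSymmetrizer k T) =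
      r • (colAntisymmetrizer k T * rowSymmetrizer k T) := by
  obtain ⟨r, hr⟩ := exists_colAntisymmetrizer_mul_mul_rowSymmetrizer T (youngSymmetrizer k T)
  have hsq : colAntisymmetrizer k T * rowSymmetrizer k T *
      (colAntisymmetrizer k T * rowSymmetrizer k T) =
      r • (colAntisymmetrizer k T * rowSymmetrizer k T) := by
    rw [← hr, youngSymmetrizer]
    simp only [mul_assoc]
  refine ⟨r, ?_, hsq⟩
  rintro rfl
  rw [zero_smul] at hsq
  refine mul_self_ne_zero_of_coeff_one_ne_zero (by simpa [Fintype.card_perm]) ?_ hsq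
  rw [coeff_one_mul_comm, ← youngSymmetrizer, coeff_one_youngSymmetrizer]
  exact one_ne_zero

end VonNeumann

section SuccPerm

variable {n : ℕ}

/-- The permutation of `Fin (n + 1)` that fixes `0` and acts by `σ` on the successors. This is the
identification of `S_n` with the stabilizer of the first position used by `groupAlgebraIncl`. -/
noncomputable def succPerm (n : ℕ) : Equiv.Perm (Fin n) →* Equiv.Perm (Fin (n + 1)) :=
  Equiv.Perm.viaEmbeddingHom (Fin.succEmb n)

@[simp]
theorem succPerm_succ (σ : Equiv.Perm (Fin n)) (i : Fin n) :
    succPerm n σ i.succ = (σ i).succ :=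
  Equiv.Perm.viaEmbedding_apply σ (Fin.succEmb n) i

@[simp]
theorem succPerm_zero (σ : Equiv.Perm (Fin n)) : succPerm n σ 0 = 0 :=
  Equiv.Perm.viaEmbedding_apply_of_notMem σ (Fin.succEmb n) 0 (by simp)

theorem sign_succPerm (σ : Equiv.Perm (Fin n)) :
    Equiv.Perm.sign (succPerm n σ) = Equiv.Perm.sign σ := by
  rw [succPerm, Equiv.Perm.viaEmbeddingHom_apply, Equiv.Perm.viaEmbedding,
    Equiv.Perm.sign_extendDomain]

theorem succPerm_mul_swap (σ : Equiv.Perm (Fin n)) (i : Fin n) :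
    succPerm n σ * Equiv.swap 0 i.succ = Equiv.swap 0 (σ i).succ * succPerm n σ := by
  rw [Equiv.mul_swap_eq_swap_mul, succPerm_zero, succPerm_succ]

theorem decomposeFin_symm_eq (p : Fin (n + 1)) (τ : Equiv.Perm (Fin n)) :
    Equiv.Perm.decomposeFin.symm (p, τ) = Equiv.swap 0 p * succPerm n τ :=
  Equiv.ext fun x => by refine Fin.cases ?_ (fun x => ?_) x <;> simp

theorem exists_eq_swap_mul_succPerm (σ : Equiv.Perm (Fin (n + 1))) :
    ∃ (p : Fin (n + 1)) (τ : Equiv.Perm (Fin n)), σ = Equiv.swap 0 p * succPerm n τ := by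
  obtain ⟨⟨p, τ⟩, rfl⟩ := Equiv.Perm.decomposeFin.symm.surjective σ
  exact ⟨p, τ, decomposeFin_symm_eq p τ⟩

theorem groupAlgebraIncl_of (k : Type*) [Field k] (σ : Equiv.Perm (Fin n)) :
    groupAlgebraIncl k n (MonoidAlgebra.of k _ σ) = MonoidAlgebra.of k _ (succPerm n σ) :=
  MonoidAlgebra.mapDomain_single

end SuccPerm

section Extension

theorem mul_mul_mul_ne_zero {k A : Type*} [Field k] [Ring A] [Algebra k A] {a b a' b' : A}
    {l m r : k} (hl : l ≠ 0) (hm : m ≠ 0) (hr : r ≠ 0) (ha : a' * a = l • a)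
    (hb : b * b' = m • b) (hba : b' * a' * (b' * a') = r • (b' * a')) (hab : a * b * (a * b) ≠ 0) :
    a * b * (a' * b') ≠ 0 := fun h0 => by
  refine hab ((smul_eq_zero.1 ?_).resolve_left (mul_ne_zero (mul_ne_zero hl hm) hr))
  calc (l * m * r) • (a * b * (a * b)) = r • (a * (b * b') * (a' * a) * b) := by
        rw [ha, hb]
        simp only [mul_smul_comm, smul_mul_assoc, smul_smul, mul_assoc]
        congr 1
        ring
    _ = a * b * (r • (b' * a')) * a * b := by
        simp only [mul_smul_comm, smul_mul_assoc, mul_assoc]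
    _ = a * (b * b') * a' * b' * a' * a * b := by
        rw [← hba]
        simp only [mul_assoc]
    _ = m • (a * b * (a' * b') * a' * a * b) := by
        rw [hb]
        simp only [mul_smul_comm, smul_mul_assoc, mul_assoc]
    _ = 0 := by rw [h0, zero_mul, zero_mul, zero_mul, smul_zero]

variable {k : Type*} [Field k] {n : ℕ} {α β : YoungDiagram} {S : Tableau α n}
  {T : Tableau β (n + 1)}

theorem succPerm_mem_youngSubgroup {κ : Type*} {f : Fin (n + 1) → κ} {σ : Equiv.Perm (Fin n)}
    (h : σ ∈ youngSubgroup (f ∘ Fin.succ)) : succPerm n σ ∈ youngSubgroup f := fun i =>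
  Fin.cases (by simp) (fun i => by simpa using h i) i

variable (hST : ∀ i : Fin n, (T i.succ : ℕ × ℕ) = S i)
include hST

theorem succPerm_mem_youngSubgroup_rowOf {σ : Equiv.Perm (Fin n)}
    (hσ : σ ∈ youngSubgroup (rowOf S)) : succPerm n σ ∈ youngSubgroup (rowOf T) :=
  succPerm_mem_youngSubgroup fun i => by simpa [rowOf, hST] using hσ i

theorem succPerm_mem_youngSubgroup_colOf {σ : Equiv.Perm (Fin n)}
    (hσ : σ ∈ youngSubgroup (colOf S)) : succPerm n σ ∈ youngSubgroup (colOf T) :=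
  succPerm_mem_youngSubgroup fun i => by simpa [colOf, hST] using hσ i

theorem incl_rowSymmetrizer_mul_rowSymmetrizer :
    groupAlgebraIncl k n (rowSymmetrizer k S) * rowSymmetrizer k T =
      Fintype.card (youngSubgroup (rowOf S)) • rowSymmetrizer k T := by
  rw [rowSymmetrizer_eq_characterSum, rowSymmetrizer_eq_characterSum]
  exact mapDomain_characterSum_mul_characterSum (succPerm n)
    (fun _ => succPerm_mem_youngSubgroup_rowOf hST) fun _ _ => rfl

theorem rowSymmetrizer_mul_incl_rowSymmetrizer :
    rowSymmetrizer k T * groupAlgebraIncl k n (rowSymmetrizer k S) =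
      Fintype.card (youngSubgroup (rowOf S)) • rowSymmetrizer k T := by
  rw [rowSymmetrizer_eq_characterSum, rowSymmetrizer_eq_characterSum]
  exact characterSum_mul_mapDomain_characterSum (succPerm n)
    (fun _ => succPerm_mem_youngSubgroup_rowOf hST) fun _ _ => rfl

theorem incl_colAntisymmetrizer_mul_colAntisymmetrizer :
    groupAlgebraIncl k n (colAntisymmetrizer k S) * colAntisymmetrizer k T =
      Fintype.card (youngSubgroup (colOf S)) • colAntisymmetrizer k T := by
  rw [colAntisymmetrizer_eq_characterSum, colAntisymmetrizer_eq_characterSum]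
  exact mapDomain_characterSum_mul_characterSum (succPerm n)
    (fun _ => succPerm_mem_youngSubgroup_colOf hST) fun σ _ => by
      rw [signChar_apply, signChar_apply, sign_succPerm]

theorem colAntisymmetrizer_mul_incl_colAntisymmetrizer :
    colAntisymmetrizer k T * groupAlgebraIncl k n (colAntisymmetrizer k S) =
      Fintype.card (youngSubgroup (colOf S)) • colAntisymmetrizer k T := by
  rw [colAntisymmetrizer_eq_characterSum, colAntisymmetrizer_eq_characterSum]
  exact characterSum_mul_mapDomain_characterSum (succPerm n)
    (fun _ => succPerm_mem_youngSubgroup_colOf hST) fun σ _ => by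
      rw [signChar_apply, signChar_apply, sign_succPerm]

theorem youngSymmetrizer_mul_groupAlgebraIncl_ne_zero (h : ((n + 1).factorial : k) ≠ 0) :
    youngSymmetrizer k T * groupAlgebraIncl k n (youngSymmetrizer k S) ≠ 0 := by
  have hn : (n.factorial : k) ≠ 0 := ne_zero_of_dvd_ne_zero h <|
    Nat.cast_dvd_cast (Nat.factorial_dvd_factorial n.le_succ)
  have hcard (H : Subgroup (Equiv.Perm (Fin n))) [Fintype H] : (Fintype.card H : k) ≠ 0 :=
    cast_card_subgroup_ne_zero (by rwa [Fintype.card_fin]) H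
  obtain ⟨r, hr0, hr⟩ := exists_colAntisymmetrizer_mul_rowSymmetrizer_mul_self hn S
  rw [youngSymmetrizer, youngSymmetrizer, map_mul]
  refine mul_mul_mul_ne_zero (hcard (youngSubgroup (rowOf S))) (hcard (youngSubgroup (colOf S))) hr0
    ?_ ?_ ?_ ?_
  · rw [incl_rowSymmetrizer_mul_rowSymmetrizer hST, Nat.cast_smul_eq_nsmul]
  · rw [colAntisymmetrizer_mul_incl_colAntisymmetrizer hST, Nat.cast_smul_eq_nsmul]
  · rw [← map_mul, ← map_mul, hr, map_smul]
  · rw [← youngSymmetrizer]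
    refine mul_self_ne_zero_of_coeff_one_ne_zero (by simpa [Fintype.card_perm]) ?_
    rw [coeff_one_youngSymmetrizer]
    exact one_ne_zero

end Extension

section JucysMurphy

variable {k : Type*} [Field k] {n : ℕ}

theorem succPerm_swap (i j : Fin n) :
    succPerm n (Equiv.swap i j) = Equiv.swap i.succ j.succ := by
  ext x
  refine Fin.cases ?_ (fun x => ?_) x
  · rw [succPerm_zero, Equiv.swap_apply_of_ne_of_ne (Fin.succ_ne_zero _).symm
      (Fin.succ_ne_zero _).symm]
  · simp only [succPerm_succ, Equiv.swap_apply_def, Fin.succ_inj, apply_ite Fin.succ]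

theorem swap_zero_succ_eq (i : Fin (n + 1)) : Equiv.swap 0 i.succ =
    succPerm _ (Equiv.swap 0 i) * Equiv.swap 0 1 * succPerm _ (Equiv.swap 0 i) := by
  rw [← Fin.succ_zero_eq_one, succPerm_mul_swap, mul_assoc, ← map_mul, Equiv.swap_mul_self,
    map_one, mul_one, Equiv.swap_apply_left]

theorem commute_map_of_forall_of {R G A : Type*} [CommSemiring R] [Monoid G] [Semiring A]
    [Algebra R A] {a : A} (φ : MonoidAlgebra R G →ₐ[R] A)
    (h : ∀ g, Commute a (φ (MonoidAlgebra.of R G g))) (x : MonoidAlgebra R G) :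
    Commute a (φ x) := by
  induction x using MonoidAlgebra.induction_on with
  | of g => exact h g
  | add x y hx hy => rw [map_add]; exact hx.add_right hy
  | smul r x hx => rw [map_smul]; exact hx.smul_right r

variable (k n) in
/-- The Jucys–Murphy element, the sum of the transpositions that move the first position. -/
noncomputable def jucysMurphy : MonoidAlgebra k (Equiv.Perm (Fin (n + 1))) :=
  ∑ i : Fin n, MonoidAlgebra.of k _ (Equiv.swap 0 i.succ)

theorem commute_jucysMurphy_groupAlgebraIncl (x : MonoidAlgebra k (Equiv.Perm (Fin n))) :
    Commute (jucysMurphy k n) (groupAlgebraIncl k n x) := by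
  refine commute_map_of_forall_of _ (fun σ => ?_) x
  rw [groupAlgebraIncl_of, commute_iff_eq, jucysMurphy, Finset.sum_mul, Finset.mul_sum]
  refine (Fintype.sum_equiv σ _ _ fun i => ?_).symm
  rw [← map_mul, ← map_mul, succPerm_mul_swap]

variable (k n) in
theorem jucysMurphy_succ_succ : jucysMurphy k (n + 2) =
    MonoidAlgebra.of k _ (Equiv.swap 0 1) + MonoidAlgebra.of k _ (Equiv.swap 0 1) *
      groupAlgebraIncl k (n + 2) (jucysMurphy k (n + 1)) *
        MonoidAlgebra.of k _ (Equiv.swap 0 1) := by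
  rw [jucysMurphy, Fin.sum_univ_succ, jucysMurphy, map_sum, Finset.mul_sum, Finset.sum_mul]
  congr 1
  refine Finset.sum_congr rfl fun i _ => ?_
  have hi : i.succ.succ ≠ 1 := by
    rw [← Fin.succ_zero_eq_one, Ne, Fin.succ_inj]
    exact Fin.succ_ne_zero i
  rw [groupAlgebraIncl_of, ← map_mul, ← map_mul, succPerm_swap, Fin.succ_zero_eq_one,
    Equiv.mul_swap_eq_swap_mul (Equiv.swap 0 1) 1, mul_assoc, Equiv.swap_mul_self, mul_one,
    Equiv.swap_apply_right, Equiv.swap_apply_of_ne_of_ne (Fin.succ_ne_zero _) hi]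

/-- The product `∏ (d + J)` over the Jucys–Murphy elements `J` of the chain
`S_1 ⊆ S_2 ⊆ ⋯ ⊆ S_(n + 1)`, where the trivial factor `d` of `S_1` is left out. -/
noncomputable def contentElement (d : k) :
    (n : ℕ) → MonoidAlgebra k (Equiv.Perm (Fin (n + 1)))
  | 0 => 1
  | n + 1 => groupAlgebraIncl k (n + 1) (contentElement d n) *
      (algebraMap k _ d + jucysMurphy k (n + 1))

theorem commute_mul_of_reflection {A : Type*} [Ring A] {s x y : A}
    (hxy : Commute x y) (h : s * y = 1 + x * s) (h' : y * s = 1 + s * x) :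
    Commute (x * y) s := by
  have hsx : s * x = y * s - 1 := by rw [h']; abel
  rw [Commute, SemiconjBy, ← mul_assoc s, hsx, sub_mul, one_mul, mul_assoc y, h, mul_add, mul_one,
    add_sub_cancel_left, hxy.eq, mul_assoc]

theorem commute_groupAlgebraIncl_groupAlgebraIncl_swap
    (x : MonoidAlgebra k (Equiv.Perm (Fin n))) :
    Commute (groupAlgebraIncl k (n + 1) (groupAlgebraIncl k n x))
      (MonoidAlgebra.of k _ (Equiv.swap 0 1)) := by
  refine (commute_map_of_forall_of ((groupAlgebraIncl k (n + 1)).comp (groupAlgebraIncl k n))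
    (fun σ => ?_) x).symm
  rw [AlgHom.comp_apply, groupAlgebraIncl_of, groupAlgebraIncl_of, commute_iff_eq, ← map_mul,
    ← map_mul, Equiv.mul_swap_eq_swap_mul, ← Fin.succ_zero_eq_one, succPerm_zero, succPerm_succ,
    succPerm_zero]

theorem commute_algebraMap_add_jucysMurphy (d : k) (x : MonoidAlgebra k (Equiv.Perm (Fin n))) :
    Commute (algebraMap k _ d + jucysMurphy k n) (groupAlgebraIncl k n x) :=
  (Algebra.commute_algebraMap_left _ _).add_left (commute_jucysMurphy_groupAlgebraIncl x)

theorem commute_contentElement_swap (d : k) : ∀ n : ℕ,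
    Commute (contentElement d (n + 1)) (MonoidAlgebra.of k _ (Equiv.swap 0 1))
  | 0 => by
    have hJ : jucysMurphy k 1 = MonoidAlgebra.of k _ (Equiv.swap 0 1) := by simp [jucysMurphy]
    rw [contentElement, contentElement, map_one, one_mul, hJ]
    exact (Algebra.commute_algebraMap_left _ _).add_left (Commute.refl _)
  | n + 1 => by
    rw [contentElement, contentElement, map_mul, mul_assoc]
    refine (commute_groupAlgebraIncl_groupAlgebraIncl_swap _).mul_left
      (commute_mul_of_reflection (commute_algebraMap_add_jucysMurphy d _).symm ?_ ?_)
    all_goals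
      rw [map_add, AlgHom.commutes, jucysMurphy_succ_succ]
      set s : MonoidAlgebra k (Equiv.Perm (Fin (n + 3))) := MonoidAlgebra.of k _ (Equiv.swap 0 1)
      have hs : s * s = 1 := by rw [← map_mul, Equiv.swap_mul_self, map_one]
      have hd : algebraMap k _ d * s = s * algebraMap k _ d := Algebra.commutes _ _
    · rw [mul_add, mul_add, ← mul_assoc, ← mul_assoc, hs, one_mul, add_mul, hd]
      abel
    · rw [add_mul, add_mul, mul_assoc, hs, mul_one, mul_add, hd]
      abel

/-- By induction `contentElement` commutes with the stabilizer of the first position, which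
together with the transposition `(0 1)` generates the symmetric group. -/
theorem commute_contentElement (d : k) : ∀ (n : ℕ)
    (x : MonoidAlgebra k (Equiv.Perm (Fin (n + 1)))), Commute (contentElement d n) x
  | 0, x => Commute.one_left x
  | n + 1, x => by
    have hsucc (σ : Equiv.Perm (Fin (n + 1))) :
        Commute (contentElement d (n + 1)) (MonoidAlgebra.of k _ (succPerm _ σ)) := by
      rw [contentElement, ← groupAlgebraIncl_of]
      exact ((commute_contentElement d n _).map _).mul_left
        (commute_algebraMap_add_jucysMurphy d _)
    refine commute_map_of_forall_of (AlgHom.id k _) (fun σ => ?_) x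
    obtain ⟨p, τ, rfl⟩ := exists_eq_swap_mul_succPerm σ
    rw [AlgHom.id_apply, map_mul]
    refine Commute.mul_right ?_ (hsucc τ)
    refine Fin.cases ?_ (fun i => ?_) p
    · rw [Equiv.swap_self, ← Equiv.Perm.one_def, map_one]
      exact Commute.one_right _
    · rw [swap_zero_succ_eq, map_mul, map_mul]
      exact ((hsucc _).mul_right (commute_contentElement_swap d n)).mul_right (hsucc _)

end JucysMurphy

section PartialTrace

variable {k : Type*} [Field k] {n : ℕ}

/-- The `k`-linear map `k[S_(n + 1)] → k[S_n]` that corresponds to the partial trace over the first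
factor of `X ^ (n + 1)` when `X` has dimension `d`. -/
noncomputable def partialTrace (d : k) (n : ℕ) :
    MonoidAlgebra k (Equiv.Perm (Fin (n + 1))) →ₗ[k] MonoidAlgebra k (Equiv.Perm (Fin n)) :=
  (MonoidAlgebra.basis _ k).constr k fun σ =>
    (if σ 0 = 0 then d else 1) • MonoidAlgebra.of k _ (Equiv.Perm.decomposeFin σ).2

theorem partialTrace_of (d : k) (p : Fin (n + 1)) (τ : Equiv.Perm (Fin n)) :
    partialTrace d n (MonoidAlgebra.of k _ (Equiv.swap 0 p * succPerm n τ)) =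
      (if p = 0 then d else 1) • MonoidAlgebra.of k _ τ := by
  rw [MonoidAlgebra.of_apply, ← MonoidAlgebra.basis_apply, partialTrace, Module.Basis.constr_basis,
    ← decomposeFin_symm_eq, Equiv.apply_symm_apply]
  simp

theorem algebraMap_add_jucysMurphy (d : k) : algebraMap k _ d + jucysMurphy k n =
    ∑ p, (if p = 0 then d else 1) • MonoidAlgebra.of k _ (Equiv.swap 0 p) := by
  simp [Fin.sum_univ_succ, jucysMurphy, ← Equiv.Perm.one_def, Algebra.algebraMap_eq_smul_one,
    MonoidAlgebra.one_def]

theorem coeff_one_swap_mul_groupAlgebraIncl_mul_swap (p q : Fin (n + 1))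
    (x : MonoidAlgebra k (Equiv.Perm (Fin n))) :
    (MonoidAlgebra.of k _ (Equiv.swap 0 p) * groupAlgebraIncl k n x *
      MonoidAlgebra.of k _ (Equiv.swap 0 q)).coeff 1 = if p = q then x.coeff 1 else 0 := by
  induction x using MonoidAlgebra.induction_on with
  | of σ =>
    have h : Equiv.swap 0 p * succPerm n σ * Equiv.swap 0 q = 1 ↔ p = q ∧ σ = 1 := by
      rw [mul_eq_one_iff_eq_inv, Equiv.swap_inv, ← mul_one (Equiv.swap 0 q),
        ← map_one (succPerm n), ← decomposeFin_symm_eq, ← decomposeFin_symm_eq,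
        EmbeddingLike.apply_eq_iff_eq, Prod.mk.injEq]
    rw [groupAlgebraIncl_of, ← map_mul, ← map_mul]
    simp [MonoidAlgebra.of_apply, Finsupp.single_apply, h, ite_and]
  | add x y hx hy =>
    rw [map_add, mul_add, add_mul, MonoidAlgebra.coeff_add, Finsupp.add_apply, hx, hy]
    split_ifs <;> simp
  | smul r x hx =>
    rw [map_smul, mul_smul_comm, smul_mul_assoc, MonoidAlgebra.coeff_smul_apply, hx]
    split_ifs <;> simp

/-- For the trace form `(x * y).coeff 1`, the partial trace is adjoint to the map
`y ↦ y * (d + J)`. -/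
theorem coeff_one_partialTrace_mul (d : k) (x : MonoidAlgebra k (Equiv.Perm (Fin (n + 1))))
    (y : MonoidAlgebra k (Equiv.Perm (Fin n))) :
    (partialTrace d n x * y).coeff 1 =
      (x * (groupAlgebraIncl k n y * (algebraMap k _ d + jucysMurphy k n))).coeff 1 := by
  induction x using MonoidAlgebra.induction_on with
  | of σ =>
    obtain ⟨p, τ, rfl⟩ := exists_eq_swap_mul_succPerm σ
    rw [partialTrace_of, smul_mul_assoc, algebraMap_add_jucysMurphy, map_mul,
      ← groupAlgebraIncl_of, mul_assoc, ← mul_assoc (groupAlgebraIncl k n _), ← map_mul,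
      ← mul_assoc, Finset.mul_sum, MonoidAlgebra.coeff_sum, Finset.sum_apply']
    simp only [mul_smul_comm, MonoidAlgebra.coeff_smul_apply,
      coeff_one_swap_mul_groupAlgebraIncl_mul_swap, smul_ite, smul_zero]
    rw [Finset.sum_ite_eq, if_pos (Finset.mem_univ p)]
  | add x y hx hy => simp [add_mul, hx, hy]
  | smul r x hx => simp [hx]

end PartialTrace

section Content

variable {k : Type*} [Field k] {n : ℕ} {β : YoungDiagram}

theorem card_filter_rowOf_eq (T : Tableau β n) (i : ℕ) :
    (Finset.univ.filter fun u => rowOf T u = i).card = β.rowLen i := by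
  rw [YoungDiagram.rowLen_eq_card]
  refine Finset.card_bij (fun u _ => (T u : ℕ × ℕ)) ?_ ?_ ?_
  · exact fun u hu => YoungDiagram.mem_row_iff.2 ⟨(T u).2, (Finset.mem_filter.1 hu).2⟩
  · exact fun u _ v _ h => T.injective (Subtype.ext h)
  · intro c hc
    obtain ⟨hcβ, hci⟩ := YoungDiagram.mem_row_iff.1 hc
    obtain ⟨u, hu1, hu2⟩ := exists_rowOf_eq_colOf_eq T hcβ
    exact ⟨u, Finset.mem_filter.2 ⟨Finset.mem_univ u, hu1.trans hci⟩, Prod.ext hu1 hu2⟩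

theorem card_filter_colOf_eq (T : Tableau β n) (j : ℕ) :
    (Finset.univ.filter fun u => colOf T u = j).card = β.colLen j := by
  rw [YoungDiagram.colLen_eq_card]
  refine Finset.card_bij (fun u _ => (T u : ℕ × ℕ)) ?_ ?_ ?_
  · exact fun u hu => YoungDiagram.mem_col_iff.2 ⟨(T u).2, (Finset.mem_filter.1 hu).2⟩
  · exact fun u _ v _ h => T.injective (Subtype.ext h)
  · intro c hc
    obtain ⟨hcβ, hci⟩ := YoungDiagram.mem_col_iff.1 hc
    obtain ⟨u, hu1, hu2⟩ := exists_rowOf_eq_colOf_eq T hcβ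
    exact ⟨u, Finset.mem_filter.2 ⟨Finset.mem_univ u, hu2.trans hci⟩, Prod.ext hu1 hu2⟩

theorem rowLen_eq_of_maximal {x : ℕ × ℕ} (hx : Maximal (· ∈ β.cells) x) :
    β.rowLen x.1 = x.2 + 1 := by
  refine le_antisymm ?_ (YoungDiagram.mem_iff_lt_rowLen.1 hx.prop)
  by_contra! h
  simpa using (hx.le_of_ge (YoungDiagram.mem_iff_lt_rowLen.2 h) ⟨le_rfl, Nat.le_succ _⟩).2

theorem colLen_eq_of_maximal {x : ℕ × ℕ} (hx : Maximal (· ∈ β.cells) x) :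
    β.colLen x.2 = x.1 + 1 := by
  refine le_antisymm ?_ (YoungDiagram.mem_iff_lt_colLen.1 hx.prop)
  by_contra! h
  simpa using (hx.le_of_ge (YoungDiagram.mem_iff_lt_colLen.2 h) ⟨Nat.le_succ _, le_rfl⟩).1

/-- If `y` lies neither in the row nor in the column of the corner `T 0`, the box `z` at which the
row of the one meets the column of the other makes the product vanish. -/
theorem rowSymmetrizer_mul_swap_mul_colAntisymmetrizer_eq_zero {T : Tableau β (n + 1)}
    (hT : Maximal (· ∈ β.cells) (T 0 : ℕ × ℕ)) {y : Fin (n + 1)} (hr : rowOf T y ≠ rowOf T 0)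
    (hc : colOf T y ≠ colOf T 0) :
    rowSymmetrizer k T * MonoidAlgebra.of k _ (Equiv.swap 0 y) * colAntisymmetrizer k T = 0 := by
  rcases lt_or_gt_of_ne hr with hlt | hgt
  · obtain ⟨z, hz1, hz2⟩ := exists_rowOf_eq_colOf_eq T (β.up_left_mem hlt.le le_rfl (T 0).2)
    have hz0 : z ≠ 0 := by rintro rfl; exact hr hz1.symm
    have hzy : z ≠ y := by rintro rfl; exact hc hz2
    refine rowSymmetrizer_mul_of_mul_colAntisymmetrizer_eq_zero hz0 hz2 ?_
    rw [Equiv.swap_apply_of_ne_of_ne hz0 hzy, Equiv.swap_apply_left, hz1]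
  · have hlt : colOf T y < colOf T 0 := by
      by_contra! hge
      exact hgt.not_ge (hT.le_of_ge (T y).2 ⟨hgt.le, hge⟩).1
    obtain ⟨z, hz1, hz2⟩ := exists_rowOf_eq_colOf_eq T (β.up_left_mem le_rfl hlt.le (T 0).2)
    have hz0 : z ≠ 0 := by rintro rfl; exact hc hz2.symm
    have hzy : z ≠ y := by rintro rfl; exact hr hz1
    refine rowSymmetrizer_mul_of_mul_colAntisymmetrizer_eq_zero hzy hz2 ?_
    rw [Equiv.swap_apply_of_ne_of_ne hz0 hzy, Equiv.swap_apply_right, hz1, rowOf]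

theorem rowSymmetrizer_mul_swap_mul_colAntisymmetrizer {T : Tableau β (n + 1)}
    (hT : Maximal (· ∈ β.cells) (T 0 : ℕ × ℕ)) {y : Fin (n + 1)} (hy : y ≠ 0) :
    rowSymmetrizer k T * MonoidAlgebra.of k _ (Equiv.swap 0 y) * colAntisymmetrizer k T =
      ((if rowOf T y = rowOf T 0 then 1 else 0) - (if colOf T y = colOf T 0 then 1 else 0) : k) •
        youngSymmetrizer k T := by
  by_cases hr : rowOf T y = rowOf T 0
  · have hc : colOf T y ≠ colOf T 0 := fun hc => hy (injective_rowOf_colOf T (Prod.ext hr hc))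
    rw [rowSymmetrizer_mul_of (swap_mem_youngSubgroup hr.symm), if_pos hr, if_neg hc, sub_zero,
      one_smul, youngSymmetrizer]
  by_cases hc : colOf T y = colOf T 0
  · rw [mul_assoc, of_mul_colAntisymmetrizer (swap_mem_youngSubgroup hc.symm), mul_smul_comm,
      signChar_apply, Equiv.Perm.sign_swap hy.symm, if_neg hr, if_pos hc, youngSymmetrizer]
    simp
  · rw [rowSymmetrizer_mul_swap_mul_colAntisymmetrizer_eq_zero hT hr hc, if_neg hr, if_neg hc,
      sub_zero, zero_smul]

theorem rowSymmetrizer_mul_jucysMurphy_mul_colAntisymmetrizer {T : Tableau β (n + 1)}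
    (hT : Maximal (· ∈ β.cells) (T 0 : ℕ × ℕ)) :
    rowSymmetrizer k T * jucysMurphy k n * colAntisymmetrizer k T =
      ((colOf T 0 : k) - (rowOf T 0 : k)) • youngSymmetrizer k T := by
  have hcount : ∑ i : Fin n, ((if rowOf T i.succ = rowOf T 0 then 1 else 0) -
      (if colOf T i.succ = colOf T 0 then 1 else 0) : k) = colOf T 0 - rowOf T 0 := by
    have h := Fin.sum_univ_succ fun y => ((if rowOf T y = rowOf T 0 then 1 else 0) -
      (if colOf T y = colOf T 0 then 1 else 0) : k)
    rw [if_pos rfl, if_pos rfl, sub_self, zero_add] at h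
    rw [← h, Finset.sum_sub_distrib, Finset.sum_boole, Finset.sum_boole, card_filter_rowOf_eq,
      card_filter_colOf_eq, rowOf, colOf, rowLen_eq_of_maximal hT, colLen_eq_of_maximal hT]
    push_cast
    ring
  rw [jucysMurphy, Finset.mul_sum, Finset.sum_mul, ← hcount, Finset.sum_smul]
  exact Finset.sum_congr rfl fun i _ =>
    rowSymmetrizer_mul_swap_mul_colAntisymmetrizer hT (Fin.succ_ne_zero i)

/-- The Young diagram `β` without a maximal box. -/
def eraseCorner {x : ℕ × ℕ} (hx : Maximal (· ∈ β.cells) x) : YoungDiagram where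
  cells := β.cells.erase x
  isLowerSet a b hba ha := by
    rw [Finset.coe_erase] at ha ⊢
    exact ⟨β.isLowerSet hba ha.1, fun hb => ha.2 (hx.eq_of_ge ha.1 (hb.symm.trans_le hba))⟩

theorem exists_tableau_extending_eraseCorner (hβ : β.card = n + 1) {x : ℕ × ℕ}
    (hx : Maximal (· ∈ β.cells) x) :
    ∃ (S : Tableau (eraseCorner hx) n) (T : Tableau β (n + 1)),
      (T 0 : ℕ × ℕ) = x ∧ ∀ i : Fin n, (T i.succ : ℕ × ℕ) = S i := by
  have hcard : (eraseCorner hx).cells.card = n := by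
    rw [eraseCorner, Finset.card_erase_of_mem hx.prop, ← YoungDiagram.card, hβ]
    rfl
  let S : Tableau (eraseCorner hx) n := (Finset.equivFinOfCardEq hcard).symm
  have hS (i) : (S i : ℕ × ℕ) ≠ x ∧ (S i : ℕ × ℕ) ∈ β.cells := Finset.mem_erase.1 (S i).2
  let t : Fin (n + 1) → β.cells := Fin.cons ⟨x, hx.prop⟩ fun i => ⟨S i, (hS i).2⟩
  have ht : Function.Injective t := by
    rw [Fin.cons_injective_iff]
    refine ⟨?_, fun i j hij => S.injective (Subtype.ext (Subtype.mk.inj hij))⟩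
    rintro ⟨i, hi⟩
    exact (hS i).1 (Subtype.ext_iff.1 hi)
  exact ⟨S, Equiv.ofBijective t ((Fintype.bijective_iff_injective_and_card t).2
    ⟨ht, by simpa using hβ.symm⟩), rfl, fun i => rfl⟩

theorem ne_zero_of_maximal_of_one_lt_card (hβ : 1 < β.card) {x : ℕ × ℕ}
    (hx : Maximal (· ∈ β.cells) x) : x ≠ 0 := by
  rintro rfl
  obtain ⟨y, hy, hy0⟩ := Finset.exists_mem_ne hβ 0
  exact hy0 (hx.eq_of_ge hy ⟨Nat.zero_le _, Nat.zero_le _⟩)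

theorem mul_mul_mul_eq_smul {A : Type*} [Ring A] [Algebra k A] {a b a' b' R y : A} {l m P e : k}
    (hl : l ≠ 0) (hm : m ≠ 0) (ha : a * a' = l • a) (hb : b' * b = m • b)
    (hR : a' * R * b' = P • (a' * b')) (hy : Commute y b') (he : a * y * b = e • (a * b)) :
    a * (R * y) * b = (e * P) • (a * b) := by
  refine smul_right_injective _ (mul_ne_zero hl hm) ?_
  change (l * m) • (a * (R * y) * b) = (l * m) • (e * P) • (a * b)
  calc (l * m) • (a * (R * y) * b) = a * a' * R * (y * b') * b := by
        rw [ha, mul_assoc _ (y * b'), mul_assoc y, hb]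
        simp only [mul_smul_comm, smul_mul_assoc, smul_smul, mul_assoc, mul_comm m l]
    _ = a * (a' * R * b') * y * b := by
        rw [hy.eq]
        simp only [mul_assoc]
    _ = P • (a * a' * (b' * y) * b) := by
        rw [hR]
        simp only [mul_smul_comm, smul_mul_assoc, mul_assoc]
    _ = (P * l * m) • (a * y * b) := by
        rw [← hy.eq, ha, ← mul_assoc, mul_assoc _ b' b, hb]
        simp only [mul_smul_comm, smul_mul_assoc, smul_smul]
        congr 1
        ring
    _ = (l * m) • (e * P) • (a * b) := by
        rw [he, smul_smul, smul_smul]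
        congr 1
        ring

theorem contentElement_mul_youngSymmetrizer_of_extends (d : k) {α : YoungDiagram}
    {S : Tableau α (n + 1)} {T : Tableau β (n + 2)} (h : ((n + 1).factorial : k) ≠ 0)
    (hT : Maximal (· ∈ β.cells) (T 0 : ℕ × ℕ))
    (hST : ∀ i : Fin (n + 1), (T i.succ : ℕ × ℕ) = S i) {P : k}
    (hS : contentElement d n * youngSymmetrizer k S = P • youngSymmetrizer k S) :
    contentElement d (n + 1) * youngSymmetrizer k T =
      ((d + ((colOf T 0 : k) - (rowOf T 0 : k))) * P) • youngSymmetrizer k T := by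
  have hcard (H : Subgroup (Equiv.Perm (Fin (n + 1)))) [Fintype H] : (Fintype.card H : k) ≠ 0 :=
    cast_card_subgroup_ne_zero (by rwa [Fintype.card_fin]) H
  rw [youngSymmetrizer, ← mul_assoc, (commute_contentElement d (n + 1) _).eq, contentElement]
  refine mul_mul_mul_eq_smul (a' := groupAlgebraIncl k (n + 1) (rowSymmetrizer k S))
    (hcard (youngSubgroup (rowOf S))) (hcard (youngSubgroup (colOf S))) ?_ ?_ ?_
    (commute_algebraMap_add_jucysMurphy d (colAntisymmetrizer k S)) ?_
  · rw [rowSymmetrizer_mul_incl_rowSymmetrizer hST, Nat.cast_smul_eq_nsmul]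
  · rw [incl_colAntisymmetrizer_mul_colAntisymmetrizer hST, Nat.cast_smul_eq_nsmul]
  · rw [← map_mul, ← map_mul, ← map_mul, ← (commute_contentElement d n _).eq, mul_assoc,
      ← youngSymmetrizer, hS, map_smul]
  · rw [mul_add, add_mul, rowSymmetrizer_mul_jucysMurphy_mul_colAntisymmetrizer hT,
      ← Algebra.commutes, mul_assoc, ← Algebra.smul_def, ← youngSymmetrizer, ← add_smul]

/-- The content polynomial of `μ` at `d`, the product of `d + (j - i)` over the boxes `(i, j)`,
without the factor `d` of the box `(0, 0)`. -/
def reducedContentProd (d : k) (μ : YoungDiagram) : k :=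
  ∏ c ∈ μ.cells.erase 0, (d + ((c.2 : k) - (c.1 : k)))

theorem reducedContentProd_eq_mul {d : k} {x : ℕ × ℕ} (hx : Maximal (· ∈ β.cells) x)
    (hx0 : x ≠ 0) : reducedContentProd d β =
      (d + ((x.2 : k) - (x.1 : k))) * reducedContentProd d (eraseCorner hx) := by
  rw [reducedContentProd, reducedContentProd, eraseCorner, Finset.erase_right_comm]
  exact (Finset.mul_prod_erase _ _ (Finset.mem_erase.2 ⟨hx0, hx.prop⟩)).symm

theorem reducedContentProd_of_card_eq_one (d : k) (hβ : β.card = 1) :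
    reducedContentProd d β = 1 := by
  obtain ⟨x, hx⟩ := Finset.card_eq_one.1 hβ
  have h0 : 0 ∈ β.cells :=
    β.isLowerSet (a := x) ⟨Nat.zero_le _, Nat.zero_le _⟩ (by simp [hx])
  rw [hx, Finset.mem_singleton] at h0
  rw [reducedContentProd, hx, h0, Finset.erase_singleton, Finset.prod_empty]

theorem contentElement_mul_youngSymmetrizer_congr {d r : k} (T₀ T : Tableau β (n + 1))
    (h : contentElement d n * youngSymmetrizer k T₀ = r • youngSymmetrizer k T₀) :
    contentElement d n * youngSymmetrizer k T = r • youngSymmetrizer k T := by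
  let g : Equiv.Perm (Fin (n + 1)) := T.trans T₀.symm
  have hg : g.trans T₀ = T := Equiv.ext fun i => by simp [g]
  have hconj := of_mul_youngSymmetrizer_trans k T₀ g
  rw [hg] at hconj
  refine ((Group.isUnit g).map (MonoidAlgebra.of k _)).mul_left_cancel ?_
  rw [← mul_assoc, ← (commute_contentElement d n _).eq, mul_assoc, hconj, ← mul_assoc, h,
    smul_mul_assoc, ← hconj, mul_smul_comm]

theorem contentElement_mul_youngSymmetrizer (d : k) : ∀ {n : ℕ}
    (_ : ((n + 1).factorial : k) ≠ 0) {β : YoungDiagram} (T : Tableau β (n + 1)),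
    contentElement d n * youngSymmetrizer k T = reducedContentProd d β • youngSymmetrizer k T
  | 0, _, β, T => by
    have hβ : β.card = 1 := by simpa using (Fintype.card_congr T).symm
    rw [reducedContentProd_of_card_eq_one d hβ, one_smul, contentElement, one_mul]
  | n + 1, h, β, T => by
    have hβ : β.card = n + 2 := by simpa using (Fintype.card_congr T).symm
    have hn : ((n + 1).factorial : k) ≠ 0 := ne_zero_of_dvd_ne_zero h <|
      Nat.cast_dvd_cast (Nat.factorial_dvd_factorial (n + 1).le_succ)
    obtain ⟨x, hx⟩ := Finset.exists_maximal (s := β.cells)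
      (Finset.card_pos.1 (hβ.symm ▸ Nat.succ_pos _ : 0 < β.card))
    obtain ⟨S, T₀, rfl, hST⟩ := exists_tableau_extending_eraseCorner hβ hx
    rw [reducedContentProd_eq_mul hx (ne_zero_of_maximal_of_one_lt_card (by omega) hx)]
    exact contentElement_mul_youngSymmetrizer_congr T₀ T <|
      contentElement_mul_youngSymmetrizer_of_extends d hn hx hST
        (contentElement_mul_youngSymmetrizer d hn S)

end Content

section SplitAlong

theorem isSplitMono_of_comp {C : Type*} [Category C] {X Y Z : C} {f : X ⟶ Y} {g : Y ⟶ Z}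
    (h : IsSplitMono (f ≫ g)) : IsSplitMono f :=
  ⟨⟨⟨g ≫ retraction (f ≫ g), by rw [← Category.assoc, IsSplitMono.id]⟩⟩⟩

variable {C : Type*} [Category C] [MonoidalCategory C]

/-- The morphism obtained from `g : Y ⊗ A ⟶ Z` by pulling back the factor `Y` along
`u : 𝟙 ⟶ D ⊗ Y`. -/
def closeUp {D Y A Z : C} (u : 𝟙_ C ⟶ D ⊗ Y) (g : Y ⊗ A ⟶ Z) : A ⟶ D ⊗ Z :=
  (λ_ A).inv ≫ u ▷ A ≫ (α_ D Y A).hom ≫ D ◁ g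

/-- The property of `g : Y ⊗ A ⟶ Z` that some `closeUp u g` is a split monomorphism. In contrast to
`closeUp (braidedCoev Y) g`, to which it reduces when `Y` has a dual, it involves no dual of `Y`. -/
def IsSplitAlong {Y A Z : C} (g : Y ⊗ A ⟶ Z) : Prop :=
  ∃ (D : C) (u : 𝟙_ C ⟶ D ⊗ Y), IsSplitMono (closeUp u g)

variable {D E X Y Y' A A' Z Z' : C}

theorem closeUp_comp (u : 𝟙_ C ⟶ D ⊗ Y) (g : Y ⊗ A ⟶ Z) (h : Z ⟶ Z') :
    closeUp u (g ≫ h) = closeUp u g ≫ D ◁ h := by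
  simp [closeUp]

theorem comp_closeUp (u : 𝟙_ C ⟶ D ⊗ Y) (f : A ⟶ A') (g : Y ⊗ A' ⟶ Z) :
    f ≫ closeUp u g = closeUp u (Y ◁ f ≫ g) := by
  simp only [closeUp, MonoidalCategory.whiskerLeft_comp, ← associator_naturality_right_assoc,
    ← whisker_exchange_assoc, leftUnitor_inv_naturality_assoc]

theorem closeUp_comp_whiskerLeft (u : 𝟙_ C ⟶ D ⊗ Y) (f : Y ⟶ Y') (g : Y' ⊗ A ⟶ Z) :
    closeUp (u ≫ D ◁ f) g = closeUp u (f ▷ A ≫ g) := by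
  simp [closeUp]

theorem closeUp_comp_whiskerRight (u : 𝟙_ C ⟶ D ⊗ Y) (w : D ⟶ E) (g : Y ⊗ A ⟶ Z) :
    closeUp (u ≫ w ▷ Y) g = closeUp u g ≫ w ▷ Z := by
  simp only [closeUp, comp_whiskerRight, Category.assoc, associator_naturality_left_assoc,
    whisker_exchange]

theorem closeUp_closeUp (u : 𝟙_ C ⟶ D ⊗ Y) (v : 𝟙_ C ⟶ E ⊗ X) (g : X ⊗ Y ⊗ A ⟶ Z) :
    closeUp u (closeUp v g) =
      closeUp (u ≫ D ◁ ((λ_ Y).inv ≫ v ▷ Y ≫ (α_ E X Y).hom) ≫ (α_ D E (X ⊗ Y)).inv)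
        ((α_ X Y A).hom ≫ g) ≫ (α_ D E Z).hom := by
  simp only [closeUp]
  monoidal

theorem IsSplitAlong.of_comp {g : Y ⊗ A ⟶ Z} {h : Z ⟶ Z'} (hgh : IsSplitAlong (g ≫ h)) :
    IsSplitAlong g := by
  obtain ⟨D, u, hu⟩ := hgh
  rw [closeUp_comp] at hu
  exact ⟨D, u, isSplitMono_of_comp hu⟩

theorem IsSplitAlong.of_whiskerRight_comp {f : Y ⟶ Y'} {g : Y' ⊗ A ⟶ Z}
    (h : IsSplitAlong (f ▷ A ≫ g)) : IsSplitAlong g := by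
  obtain ⟨D, u, hu⟩ := h
  exact ⟨D, u ≫ D ◁ f, by rwa [closeUp_comp_whiskerLeft]⟩

theorem IsSplitAlong.of_closeUp {v : 𝟙_ C ⟶ E ⊗ X} {g : X ⊗ Y ⊗ A ⟶ Z}
    (h : IsSplitAlong (closeUp v g)) : IsSplitAlong ((α_ X Y A).hom ≫ g) := by
  obtain ⟨D, u, hu⟩ := h
  rw [closeUp_closeUp] at hu
  exact ⟨_, _, isSplitMono_of_comp hu⟩

theorem isSplitAlong_of_isIso (g : 𝟙_ C ⊗ A ⟶ Z) [IsIso g] : IsSplitAlong g :=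
  ⟨𝟙_ C, (λ_ (𝟙_ C)).inv, by rw [closeUp]; infer_instance⟩

variable [SymmetricCategory C]

theorem braiding_tensor_comp_braiding_tensor (X Y Z : C) :
    (β_ (X ⊗ Y) Z).hom ≫ (α_ Z X Y).inv ≫ (β_ (Z ⊗ X) Y).hom =
      (β_ X Y).hom ▷ Z ≫ (α_ Y X Z).hom ≫ Y ◁ (β_ X Z).hom := by
  have symm : X ◁ (β_ Y Z).hom ≫ X ◁ (β_ Z Y).hom = 𝟙 _ := by
    rw [← MonoidalCategory.whiskerLeft_comp, SymmetricCategory.symmetry,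
      MonoidalCategory.whiskerLeft_id]
  simp only [BraidedCategory.braiding_tensor_left_hom X Y Z, Category.assoc,
    Iso.hom_inv_id_assoc, BraidedCategory.braiding_naturality_left]
  simp [BraidedCategory.braiding_tensor_left_hom X Z Y, reassoc_of% symm]

variable [RightRigidCategory C]

/-- The coevaluation with its two factors exchanged, `𝟙 ⟶ Xᘁ ⊗ X`. -/
def braidedCoev (X : C) : 𝟙_ C ⟶ Xᘁ ⊗ X := η_ X Xᘁ ≫ (β_ X Xᘁ).hom

theorem exists_eq_braidedCoev_comp_whiskerRight (u : 𝟙_ C ⟶ D ⊗ Y) :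
    ∃ w : Yᘁ ⟶ D, u = braidedCoev Y ≫ w ▷ Y := by
  obtain ⟨f, hf⟩ := (tensorLeftHomEquiv (𝟙_ C) Y Yᘁ D).surjective (u ≫ (β_ D Y).hom)
  have hη : η_ Y Yᘁ ≫ Y ◁ ((ρ_ Yᘁ).inv ≫ f) = u ≫ (β_ D Y).hom := by
    rw [← hf]
    simp [tensorLeftHomEquiv, unitors_inv_equal]
  refine ⟨(ρ_ Yᘁ).inv ≫ f, ?_⟩
  rw [braidedCoev, Category.assoc, ← BraidedCategory.braiding_naturality_right, reassoc_of% hη,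
    SymmetricCategory.symmetry, Category.comp_id]

theorem isSplitAlong_iff_isSplitMono_closeUp_braidedCoev {g : Y ⊗ A ⟶ Z} :
    IsSplitAlong g ↔ IsSplitMono (closeUp (braidedCoev Y) g) := by
  refine ⟨fun ⟨D, u, hu⟩ => ?_, fun h => ⟨_, _, h⟩⟩
  obtain ⟨w, rfl⟩ := exists_eq_braidedCoev_comp_whiskerRight u
  rw [closeUp_comp_whiskerRight] at hu
  exact isSplitMono_of_comp hu

theorem coevaluation_comp_braiding_eq_closeUp (p : A ⊗ Y ⟶ Z) :
    ((ρ_ A).inv ≫ A ◁ η_ Y Yᘁ ≫ (α_ A Y Yᘁ).inv ≫ p ▷ Yᘁ) ≫ (β_ Z Yᘁ).hom =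
      closeUp (braidedCoev Y) ((β_ Y A).hom ≫ p) := by
  have hη : (ρ_ A).inv ≫ A ◁ η_ Y Yᘁ = (λ_ A).inv ≫ η_ Y Yᘁ ▷ A ≫ (β_ (Y ⊗ Yᘁ) A).hom := by
    rw [BraidedCategory.braiding_naturality_left]
    simp
  simp only [Category.assoc, BraidedCategory.braiding_naturality_left, reassoc_of% hη,
    reassoc_of% braiding_tensor_comp_braiding_tensor]
  simp [closeUp, braidedCoev]

theorem isSplitMono_of_isSplitAlong_braiding_comp {p : A ⊗ Y ⟶ Z}
    (hp : IsSplitAlong ((β_ Y A).hom ≫ p)) :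
    IsSplitMono ((ρ_ A).inv ≫ A ◁ η_ Y Yᘁ ≫ (α_ A Y Yᘁ).inv ≫ p ▷ Yᘁ) := by
  rw [isSplitAlong_iff_isSplitMono_closeUp_braidedCoev,
    ← coevaluation_comp_braiding_eq_closeUp] at hp
  exact isSplitMono_of_comp hp

end SplitAlong

section TraceFirst

variable {C : Type*} [Category C] [MonoidalCategory C] [SymmetricCategory C]
  [RightRigidCategory C]

/-- The partial trace over the first factor. -/
def traceFirst (X : C) {W W' : C} (g : X ⊗ W ⟶ X ⊗ W') : W ⟶ W' :=
  closeUp (braidedCoev X) g ≫ (α_ _ _ _).inv ≫ ε_ X Xᘁ ▷ W' ≫ (λ_ W').hom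

variable {X W W' W'' : C}

theorem traceFirst_comp_whiskerLeft (g : X ⊗ W ⟶ X ⊗ W') (h : W' ⟶ W'') :
    traceFirst X (g ≫ X ◁ h) = traceFirst X g ≫ h := by
  simp only [traceFirst, closeUp_comp, Category.assoc, associator_inv_naturality_right_assoc,
    whisker_exchange_assoc, leftUnitor_naturality]

theorem traceFirst_whiskerLeft_comp (h : W ⟶ W') (g : X ⊗ W' ⟶ X ⊗ W'') :
    traceFirst X (X ◁ h ≫ g) = h ≫ traceFirst X g := by
  rw [traceFirst, ← comp_closeUp, Category.assoc, traceFirst]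

variable (X W) in
theorem traceFirst_id : traceFirst X (𝟙 (X ⊗ W)) =
    (λ_ W).inv ≫ (η_ X Xᘁ ≫ (β_ X Xᘁ).hom ≫ ε_ X Xᘁ) ▷ W ≫ (λ_ W).hom := by
  simp [traceFirst, closeUp, braidedCoev]

/-- Sliding the strand through the crossing turns this into the zigzag identity. -/
theorem closeUp_braiding_comp_evaluation (X : C) :
    closeUp (braidedCoev X) (β_ X X).hom ≫ (α_ _ _ _).inv ≫ ε_ X Xᘁ ▷ X ≫ (λ_ X).hom = 𝟙 X := by
  have h := BraidedCategory.hexagon_forward X Xᘁ X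
  rw [closeUp, braidedCoev, comp_whiskerRight]
  simp only [Category.assoc]
  rw [← reassoc_of% h, Iso.hom_inv_id_assoc, ← BraidedCategory.braiding_naturality_right_assoc,
    reassoc_of% ExactPairing.evaluation_coevaluation X Xᘁ]
  simp

variable (X W) in
theorem traceFirst_swapFirst : traceFirst X (swapFirst X W) = 𝟙 (X ⊗ W) := by
  have h := congrArg (fun f => f ▷ W) (closeUp_braiding_comp_evaluation X)
  simp only [id_whiskerRight] at h
  rw [← h, traceFirst, closeUp, closeUp, swapFirst]
  monoidal

theorem IsSplitAlong.of_comp_traceFirst {Y A : C} {f : Y ⊗ A ⟶ W} {g : X ⊗ W ⟶ X ⊗ W'}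
    (h : IsSplitAlong (f ≫ traceFirst X g)) : IsSplitAlong ((α_ X Y A).hom ≫ X ◁ f ≫ g) := by
  rw [traceFirst, ← Category.assoc, comp_closeUp] at h
  exact h.of_comp.of_closeUp

end TraceFirst

section PermMap

variable {C : Type*} [Category C] [MonoidalCategory C] [SymmetricCategory C]

theorem permTail_succPerm {n : ℕ} (σ : Equiv.Perm (Fin n)) : permTail (succPerm n σ) = σ :=
  permTail_unique fun i => by simp

theorem permMap_succPerm (X : C) {n : ℕ} (σ : Equiv.Perm (Fin n)) :
    permMap X (n + 1) (succPerm n σ) = X ◁ permMap X n σ := by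
  rw [permMap, permTail_succPerm, succPerm_zero]
  cases n <;> exact Category.comp_id _

theorem permMap_swap_zero_one (X : C) (n : ℕ) :
    permMap X (n + 2) (Equiv.swap 0 1) = swapFirst X (tensorPow X n) :=
  permAction_adjacent X (n + 1) 0

theorem associator_comp_whiskerLeft_braiding_comp_swapFirst (X Y : C) :
    (α_ X Y X).hom ≫ X ◁ (β_ Y X).hom ≫ swapFirst X Y = (β_ (X ⊗ Y) X).hom :=
  (BraidedCategory.braiding_tensor_left_hom X Y X).symm

variable [RightRigidCategory C]

theorem traceFirst_permMap_swap_zero_succ (X : C) {n : ℕ} (i : Fin (n + 1)) :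
    traceFirst X (permMap X (n + 2) (Equiv.swap 0 i.succ)) = 𝟙 (tensorPow X (n + 1)) := by
  rw [swap_zero_succ_eq, permMap_mul, permMap_mul, permMap_succPerm, permMap_swap_zero_one,
    traceFirst_whiskerLeft_comp, traceFirst_comp_whiskerLeft, traceFirst_swapFirst]
  erw [Category.id_comp]
  rw [← permMap_mul, Equiv.swap_mul_self, permMap_one]

end PermMap

section GroupAlgebraAction

variable {k : Type*} [Field k] {C : Type*} [Category C] [Preadditive C] [Linear k C]
  [MonoidalCategory C] [SymmetricCategory C]

theorem groupAlgebraAction_of (X : C) {n : ℕ} (σ : Equiv.Perm (Fin n)) :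
    (groupAlgebraAction k X n (MonoidAlgebra.of k _ σ) : tensorPow X n ⟶ tensorPow X n) =
      permMap X n σ := by
  rw [groupAlgebraAction, MonoidAlgebra.lift_of]
  rfl

theorem groupAlgebraAction_mul (X : C) {n : ℕ} (x y : MonoidAlgebra k (Equiv.Perm (Fin n))) :
    (groupAlgebraAction k X n (x * y) : tensorPow X n ⟶ tensorPow X n) =
      groupAlgebraAction k X n y ≫ groupAlgebraAction k X n x :=
  map_mul (groupAlgebraAction k X n) x y

variable [MonoidalPreadditive C] [MonoidalLinear k C]

theorem groupAlgebraAction_groupAlgebraIncl (X : C) {n : ℕ}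
    (x : MonoidAlgebra k (Equiv.Perm (Fin n))) :
    (groupAlgebraAction k X (n + 1) (groupAlgebraIncl k n x) :
      tensorPow X (n + 1) ⟶ tensorPow X (n + 1)) = X ◁ groupAlgebraAction k X n x := by
  induction x using MonoidAlgebra.induction_on with
  | of σ => rw [groupAlgebraIncl_of, groupAlgebraAction_of, groupAlgebraAction_of,
      permMap_succPerm]
  | add a b ha hb =>
    rw [map_add, map_add, map_add]
    exact (congrArg₂ (· + ·) ha hb).trans (MonoidalPreadditive.whiskerLeft_add _ _).symm
  | smul r a ha =>
    rw [map_smul, map_smul, map_smul]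
    exact (congrArg (r • ·) ha).trans (MonoidalLinear.whiskerLeft_smul ..).symm

variable [RightRigidCategory C] {X : C}

theorem traceFirst_add {W W' : C} (f g : X ⊗ W ⟶ X ⊗ W') :
    traceFirst X (f + g) = traceFirst X f + traceFirst X g := by
  simp [traceFirst, closeUp]

theorem traceFirst_smul {W W' : C} (r : k) (f : X ⊗ W ⟶ X ⊗ W') :
    traceFirst X (r • f) = r • traceFirst X f := by
  simp [traceFirst, closeUp]

variable {d : k} (hd : η_ X Xᘁ ≫ (β_ X Xᘁ).hom ≫ ε_ X Xᘁ = d • 𝟙 (𝟙_ C))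
include hd

theorem groupAlgebraAction_partialTrace {n : ℕ}
    (x : MonoidAlgebra k (Equiv.Perm (Fin (n + 2)))) :
    (groupAlgebraAction k X (n + 1) (partialTrace d (n + 1) x) :
      tensorPow X (n + 1) ⟶ tensorPow X (n + 1)) =
      traceFirst X (W := tensorPow X (n + 1)) (W' := tensorPow X (n + 1))
        (groupAlgebraAction k X (n + 2) x) := by
  induction x using MonoidAlgebra.induction_on with
  | of σ =>
    obtain ⟨p, τ, rfl⟩ := exists_eq_swap_mul_succPerm σ
    rw [partialTrace_of, map_smul, groupAlgebraAction_of, groupAlgebraAction_of, permMap_mul,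
      permMap_succPerm, traceFirst_whiskerLeft_comp]
    refine Fin.cases ?_ (fun p => ?_) p
    · rw [if_pos rfl, Equiv.swap_self, ← Equiv.Perm.one_def, permMap_one, traceFirst_id, hd]
      simp
    · rw [if_neg (Fin.succ_ne_zero p), one_smul, traceFirst_permMap_swap_zero_succ]
      exact (Category.comp_id _).symm
  | add a b ha hb =>
    rw [map_add, map_add, map_add]
    exact (congrArg₂ (· + ·) ha hb).trans (traceFirst_add _ _).symm
  | smul r a ha =>
    rw [map_smul, map_smul, map_smul]
    exact (congrArg (r • ·) ha).trans (traceFirst_smul r _).symm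

theorem isSplitAlong_braiding_comp_groupAlgebraAction : ∀ {n : ℕ}
    {x : MonoidAlgebra k (Equiv.Perm (Fin (n + 1)))}, contentElement d n * x ≠ 0 →
      IsSplitAlong (Y := tensorPow X n) (A := X) (Z := tensorPow X (n + 1))
        ((β_ (tensorPow X n) X).hom ≫ groupAlgebraAction k X (n + 1) x)
  | 0, x, hx => by
    have scalar : x = algebraMap k _ (x.coeff 1) := by
      ext σ
      simp [Subsingleton.elim (α := Equiv.Perm (Fin 1)) σ 1]
    have unit : IsUnit x := by
      rw [scalar]
      refine (IsUnit.mk0 _ fun h => hx ?_).map _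
      rw [scalar, h, map_zero, mul_zero]
    have := (isUnit_iff_isIso (groupAlgebraAction k X 1 x)).1 (unit.map _)
    exact isSplitAlong_of_isIso _
  | n + 1, x, hx => by
    let s := MonoidAlgebra.of k (Equiv.Perm (Fin (n + 2))) (Equiv.swap 0 1)
    have hs : contentElement d (n + 1) * x * s ≠ 0 := fun h => hx (by
      rw [← mul_one x, ← map_one (MonoidAlgebra.of k _), ← Equiv.swap_mul_self 0 1, map_mul,
        ← mul_assoc, ← mul_assoc, h, zero_mul])
    obtain ⟨σ, hσ⟩ := exists_coeff_one_of_mul_ne_zero hs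
    let f := MonoidAlgebra.of k _ σ
    have hy : contentElement d n * partialTrace d (n + 1) (f * x * s) ≠ 0 := fun h => hσ (by
      rw [mul_assoc, (commute_contentElement d (n + 1) _).eq, ← mul_assoc, ← mul_assoc,
        contentElement, ← coeff_one_partialTrace_mul, ← (commute_contentElement d n _).eq, h]
      simp)
    have ih := isSplitAlong_braiding_comp_groupAlgebraAction hy
    rw [groupAlgebraAction_partialTrace hd, groupAlgebraAction_mul, groupAlgebraAction_mul,
      groupAlgebraAction_of, permMap_swap_zero_one] at ih
    have h := ih.of_comp_traceFirst
    rw [reassoc_of% associator_comp_whiskerLeft_braiding_comp_swapFirst, ← Category.assoc] at h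
    exact h.of_comp

end GroupAlgebraAction

section Theta

theorem dim_spec (k : Type*) [Field k] {C : Type*} [Category C] [Abelian C] [Linear k C]
    [MonoidalCategory C] [SymmetricCategory C] [RightRigidCategory C] [IsTensorCategory k C]
    (X : C) : η_ X Xᘁ ≫ (β_ X Xᘁ).hom ≫ ε_ X Xᘁ = dim k X • 𝟙 (𝟙_ C) :=
  ((Equiv.ofBijective _ (IsTensorCategory.end_unit (k := k) (C := C))).apply_symm_apply
    (η_ X Xᘁ ≫ (β_ X Xᘁ).hom ≫ ε_ X Xᘁ : 𝟙_ C ⟶ 𝟙_ C)).symm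

variable {k : Type*} [Field k] {C : Type*} [Category C] [Abelian C] [Linear k C]
  [MonoidalCategory C] [MonoidalPreadditive C] [MonoidalLinear k C] [SymmetricCategory C]
  [RightRigidCategory C] {X : C} {d : k}
  (hd : η_ X Xᘁ ≫ (β_ X Xᘁ).hom ≫ ε_ X Xᘁ = d • 𝟙 (𝟙_ C)) {α β : YoungDiagram} {n : ℕ}
  {S : Tableau α n} {T : Tableau β (n + 1)}
include hd

theorem isSplitMono_theta (h : contentElement d n *
    (youngSymmetrizer k T * groupAlgebraIncl k n (youngSymmetrizer k S)) ≠ 0) :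
    IsSplitMono (theta k S T X) := by
  have split := isSplitAlong_braiding_comp_groupAlgebraAction hd h
  rw [groupAlgebraAction_mul, groupAlgebraAction_groupAlgebraIncl] at split
  change IsSplitAlong ((β_ _ X).hom ≫ X ◁ youngMap k S X ≫ youngMap k T X) at split
  rw [← Limits.image.fac (youngMap k S X), ← Limits.image.fac (youngMap k T X),
    MonoidalCategory.whiskerLeft_comp_assoc,
    ← BraidedCategory.braiding_naturality_left_assoc] at split
  have split' : IsSplitAlong (((β_ _ X).hom ≫ X ◁ Limits.image.ι (youngMap k S X) ≫
      Limits.factorThruImage (youngMap k T X)) ≫ Limits.image.ι (youngMap k T X)) := by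
    simpa only [Category.assoc] using split.of_whiskerRight_comp
  exact isSplitMono_of_isSplitAlong_braiding_comp split'.of_comp

theorem isSplitMono_theta_of_forall_ne (h : ((n + 1).factorial : k) ≠ 0)
    (hST : youngSymmetrizer k T * groupAlgebraIncl k n (youngSymmetrizer k S) ≠ 0)
    (hβ : ∀ i j : ℕ, (i, j) ∈ β → (i, j) ≠ (0, 0) → d ≠ ((i - j : ℤ) : k)) :
    IsSplitMono (theta k S T X) := by
  have content_ne_zero : reducedContentProd d β ≠ 0 := by
    refine Finset.prod_ne_zero_iff.2 fun c hc h0 => ?_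
    rw [Finset.mem_erase] at hc
    refine hβ c.1 c.2 hc.2 hc.1 ?_
    push_cast
    linear_combination h0
  refine isSplitMono_theta hd ?_
  rw [← mul_assoc, contentElement_mul_youngSymmetrizer d h, smul_mul_assoc]
  exact smul_ne_zero content_ne_zero hST

end Theta

theorem factorial_ne_zero_of_lt_ringChar {k : Type*} [Field k] {m : ℕ}
    (h : ringChar k = 0 ∨ m < ringChar k) : (m.factorial : k) ≠ 0 := by
  rw [Ne, ringChar.spec]
  rcases h with h | h
  · rw [h, zero_dvd_iff]
    exact m.factorial_ne_zero
  · have prime : (ringChar k).Prime :=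
      (CharP.char_is_prime_or_zero k (ringChar k)).resolve_right (by omega)
    rwa [prime.dvd_factorial, not_le]

section Box

variable {μ : YoungDiagram} {i j : ℕ}

theorem one_sub_rowLen_le_of_mem (h : (i, j) ∈ μ) : 1 - (μ.rowLen 0 : ℤ) ≤ i - j := by
  have := YoungDiagram.mem_iff_lt_rowLen.1 (μ.up_left_mem i.zero_le le_rfl h)
  omega

theorem le_colLen_sub_one_of_mem (h : (i, j) ∈ μ) : (i - j : ℤ) ≤ μ.colLen 0 - 1 := by
  have := YoungDiagram.mem_iff_lt_colLen.1 (μ.up_left_mem le_rfl j.zero_le h)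
  omega

theorem IsHook.eq_zero_of_mem_diagonal (hμ : IsHook μ) (h : (i, i) ∈ μ) : i = 0 := by
  by_contra hi
  have one_le : 1 ≤ i := Nat.one_le_iff_ne_zero.2 hi
  exact hμ (μ.up_left_mem one_le one_le h)

end Box

end SchurFunctor

theorem mainTheorem7_general (k : Type*) [Field k] {C : Type*} [Category C] [Abelian C]
    [Linear k C] [MonoidalCategory C] [MonoidalPreadditive C] [MonoidalLinear k C]
    [SymmetricCategory C] [RightRigidCategory C] (X : C) (d : k)
    (hd : η_ X Xᘁ ≫ (β_ X Xᘁ).hom ≫ ε_ X Xᘁ = d • 𝟙 (𝟙_ C)) (n : ℕ)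
    (hchar : ringChar k = 0 ∨ n + 1 < ringChar k) (α β : YoungDiagram) :
    (∀ (S : SchurFunctor.Tableau α n) (T : SchurFunctor.Tableau β (n + 1)),
      (∀ i : Fin n, (T i.succ : ℕ × ℕ) = S i) →
        SchurFunctor.youngSymmetrizer k T *
          SchurFunctor.groupAlgebraIncl k n (SchurFunctor.youngSymmetrizer k S) ≠ 0) ∧
    (∀ (S : SchurFunctor.Tableau α n) (T : SchurFunctor.Tableau β (n + 1)),
      SchurFunctor.youngSymmetrizer k T *
          SchurFunctor.groupAlgebraIncl k n (SchurFunctor.youngSymmetrizer k S) ≠ 0 →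
        ((∀ i : ℤ, 1 - (β.rowLen 0 : ℤ) ≤ i → i ≤ (β.colLen 0 : ℤ) - 1 →
            d ≠ (i : k)) →
          IsSplitMono (SchurFunctor.theta k S T X)) ∧
        (SchurFunctor.IsHook β →
          (∀ i : ℤ, 1 - (β.rowLen 0 : ℤ) ≤ i → i ≤ (β.colLen 0 : ℤ) - 1 → i ≠ 0 →
            d ≠ (i : k)) →
          IsSplitMono (SchurFunctor.theta k S T X))) := by
  have h := SchurFunctor.factorial_ne_zero_of_lt_ringChar hchar
  refine ⟨fun S T hST => SchurFunctor.youngSymmetrizer_mul_groupAlgebraIncl_ne_zero hST h,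
    fun S T hST => ⟨fun ne => ?_, fun hook ne => ?_⟩⟩
  · exact SchurFunctor.isSplitMono_theta_of_forall_ne hd h hST fun i j hij _ =>
      ne _ (SchurFunctor.one_sub_rowLen_le_of_mem hij) (SchurFunctor.le_colLen_sub_one_of_mem hij)
  · refine SchurFunctor.isSplitMono_theta_of_forall_ne hd h hST fun i j hij hij0 =>
      ne _ (SchurFunctor.one_sub_rowLen_le_of_mem hij) (SchurFunctor.le_colLen_sub_one_of_mem hij)
        fun h0 => hij0 ?_
    obtain rfl : i = j := by omega
    rw [hook.eq_zero_of_mem_diagonal hij]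

theorem mainTheorem7 (k : Type*) [Field k] {C : Type*} [Category C] [Abelian C] [Linear k C]
    [MonoidalCategory C] [MonoidalPreadditive C] [MonoidalLinear k C] [SymmetricCategory C]
    [RigidCategory C] [SchurFunctor.IsTensorCategory k C] (X : C) (n : ℕ)
    (hchar : ringChar k = 0 ∨ n + 1 < ringChar k) (α β : YoungDiagram) (hα : α.card = n)
    (hβ : β.card = n + 1) (hαβ : α ≤ β) :
    (∀ (S : SchurFunctor.Tableau α n) (T : SchurFunctor.Tableau β (n + 1)),
      (∀ i : Fin n, (T i.succ : ℕ × ℕ) = S i) →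
        SchurFunctor.youngSymmetrizer k T *
          SchurFunctor.groupAlgebraIncl k n (SchurFunctor.youngSymmetrizer k S) ≠ 0) ∧
    (∀ (S : SchurFunctor.Tableau α n) (T : SchurFunctor.Tableau β (n + 1)),
      SchurFunctor.youngSymmetrizer k T *
          SchurFunctor.groupAlgebraIncl k n (SchurFunctor.youngSymmetrizer k S) ≠ 0 →
        ((∀ i : ℤ, 1 - (β.rowLen 0 : ℤ) ≤ i → i ≤ (β.colLen 0 : ℤ) - 1 →
            SchurFunctor.dim k X ≠ (i : k)) →
          IsSplitMono (SchurFunctor.theta k S T X)) ∧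
        (SchurFunctor.IsHook β →
          (∀ i : ℤ, 1 - (β.rowLen 0 : ℤ) ≤ i → i ≤ (β.colLen 0 : ℤ) - 1 → i ≠ 0 →
            SchurFunctor.dim k X ≠ (i : k)) →
          IsSplitMono (SchurFunctor.theta k S T X))) :=
  mainTheorem7_general k X (SchurFunctor.dim k X) (SchurFunctor.dim_spec k X) n hchar α β
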